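/- Let $n \ge 1$ and $\beta \in (0,\infty]$. Let $\lambda^{(n,0)} = (\lambda^{(n,0)}_j)_{1\le j\le n}$ be a (possibly random) nondecreasing sequence of real numbers, and put $P_{n,0}(z) = \prod_{j=1}^n (z-\lambda^{(n,0)}_j)$. For $1\le m\le n$, let $\rho^{(n,m)} = (\rho^{(n,m)}_j)_{1\le j\le n+1-m}$ be a random vector following the Dirichlet distribution with all parameters equal to $\beta/2$ if $\beta<\infty$, and let $\rho^{(n,m)}_j = 1/(n+1-m)$ for all $j$ if $\beta=\infty$; the vectors $\rho^{(n,1)},\dots,\rho^{(n,n)}$ and the sequence $\lambda^{(n,0)}$ are all independent. For $1\le m\le n$, define inductively $$P_{n,m}(z) = \sum_{j=1}^{n+1-m} \rho^{(n,m)}_j \prod_{1\le k\le n+1-m,\ k\ne j} \bigl(z-\lambda^{(n,m-1)}_k\bigr),$$ and let $(\lambda^{(n,m)}_j)_{1\le j\le n-m}$ be the nondecreasing sequence of the roots of $P_{n,m}$, counted with multiplicity (almost surely, all these roots are real). (i) If $\beta=\infty$, then for all $0\le m\le n$, $$P_{n,m} = \frac{(n-m)!}{n!}\, P_{n,0}^{(m)},$$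 where $P_{n,0}^{(m)}$ is the $m$-th derivative of $P_{n,0}$. (ii) If $\beta=2$ (respectively $\beta=1$), then $(P_{n,m})_{0\le m\le n-1}$ has the same joint distribution as the sequence, indexed by $0\le m\le n-1$, of the characteristic polynomials of the top-left $(n-m)\times(n-m)$ blocks of the $n\times n$ matrix $$M_n = U_n^*\,\mathrm{Diag}\bigl(\lambda^{(n,0)}_1,\dots,\lambda^{(n,0)}_n\bigr)\,U_n,$$ where $U_n$ is independent of $\lambda^{(n,0)}$ and Haar-distributed on the unitary group $U(n)$ (respectively on the orthogonal group $O(n)$). -/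

import Mathlib

open MeasureTheory ProbabilityTheory Polynomial
open scoped ENNReal

noncomputable section

/-- The `σ`-algebra on polynomials generated by the coefficients.
On polynomials of bounded degree over `ℝ` or `ℂ` it is the Borel `σ`-algebra. -/
instance Polynomial.coeffMeasurableSpace {R : Type*} [Semiring R] [MeasurableSpace R] :
    MeasurableSpace R[X] :=
  MeasurableSpace.comap (fun (p : R[X]) (i : ℕ) => p.coeff i) inferInstance

/-- The Borel `σ`-algebra on `U(n)` (for `𝕜 = ℂ`) and on `O(n)` (for `𝕜 = ℝ`). -/
instance Matrix.unitaryGroup.borelMeasurableSpace {n : ℕ} {𝕜 : Type*} [RCLike 𝕜] :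
    MeasurableSpace (Matrix.unitaryGroup (Fin n) 𝕜) :=
  borel _

instance Matrix.unitaryGroup.borelSpace {n : ℕ} {𝕜 : Type*} [RCLike 𝕜] :
    BorelSpace (Matrix.unitaryGroup (Fin n) 𝕜) :=
  ⟨rfl⟩

/-- The Dirichlet distribution with parameters `a j > 0`: the law of `γ_j / ∑ l, γ_l`, where the
`γ_j` are independent Gamma variables of shape `a j` and rate `1`. -/
def dirichletMeasure {k : ℕ} (a : Fin k → ℝ) : Measure (Fin k → ℝ) :=
  (Measure.pi fun j => gammaMeasure (a j) 1).map fun x j => x j / ∑ l, x l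

/-- The real roots of `p`, with multiplicity, listed in nondecreasing order. (When `p` is a real
polynomial of degree `k` with only real roots, the default value `0` is never used.) -/
def sortedRoots (k : ℕ) (p : ℝ[X]) : Fin k → ℝ :=
  fun j => (p.roots.sort (· ≤ ·)).getD j 0

/-- `∏ j, (z - x j)`. -/
def polyOfRoots {k : ℕ} (x : Fin k → ℝ) : ℝ[X] :=
  ∏ j, (X - C (x j))

/-- `∑ j, w j * ∏_{i ≠ j} (z - x i)`. -/
def weightedDerivative {k : ℕ} (x w : Fin k → ℝ) : ℝ[X] :=
  ∑ j, C (w j) * ∏ i ∈ Finset.univ.erase j, (X - C (x i))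

/-- The nondecreasing sequence `λ^{(n,m)}` of the `n - m` roots of `P_{n,m}`. The vector
`ρ^{(n,m+1)}`, of length `n - m`, which is used to pass from `P_{n,m}` to `P_{n,m+1}`,
is here `rho m`. -/
def rootSeq {n : ℕ} (lam : Fin n → ℝ) (rho : (m : ℕ) → Fin (n - m) → ℝ) :
    (m : ℕ) → Fin (n - m) → ℝ
  | 0 => lam
  | m + 1 => sortedRoots (n - (m + 1)) (weightedDerivative (rootSeq lam rho m) (rho m))

/-- The polynomial `P_{n,m}`. -/
def polySeq {n : ℕ} (lam : Fin n → ℝ) (rho : (m : ℕ) → Fin (n - m) → ℝ) : ℕ → ℝ[X]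
  | 0 => polyOfRoots lam
  | m + 1 => weightedDerivative (rootSeq lam rho m) (rho m)

/-- The random inputs of the construction with parameter `β ∈ (0, ∞]`: a random nondecreasing
sequence `lam` of `n` real numbers, and, for `0 ≤ m < n`, a random vector `rho m` of length `n - m`,
which has the Dirichlet distribution with all parameters equal to `β / 2` if `β < ∞` and is constant
equal to `1 / (n - m)` if `β = ∞`; `lam`, `rho 0`, ..., `rho (n - 1)` are mutually independent.
(The vectors `rho m` with `m ≥ n` are empty and irrelevant.) -/
structure IsBetaInput {Ω : Type*} [MeasurableSpace Ω] (μ : Measure Ω) (β : ℝ≥0∞) (n : ℕ)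
    (lam : Ω → Fin n → ℝ) (rho : (m : ℕ) → Ω → Fin (n - m) → ℝ) : Prop where
  beta_pos : 0 < β
  measurable_lam : Measurable lam
  monotone_lam : ∀ ω, Monotone (lam ω)
  law_rho : β ≠ ∞ → ∀ m < n, HasLaw (rho m) (dirichletMeasure fun _ => β.toReal / 2) μ
  rho_eq : β = ∞ → ∀ m < n, ∀ ω j, rho m ω j = 1 / ((n : ℝ) - m)
  iIndepFun_rho : iIndepFun (fun m : Fin n => rho m) μ
  indepFun_lam_rho : IndepFun lam (fun ω (m : Fin n) => rho m ω) μ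

/-- The matrix `U* Diag(lam) U`. -/
def conjDiag {n : ℕ} {𝕜 : Type*} [RCLike 𝕜] (lam : Fin n → ℝ)
    (U : Matrix.unitaryGroup (Fin n) 𝕜) : Matrix (Fin n) (Fin n) 𝕜 :=
  star (U : Matrix (Fin n) (Fin n) 𝕜) * Matrix.diagonal (fun j => (lam j : 𝕜)) *
    (U : Matrix (Fin n) (Fin n) 𝕜)

/-- The top-left `(n - m) × (n - m)` block of `M`. -/
def topLeftMinor {n : ℕ} {𝕜 : Type*} (M : Matrix (Fin n) (Fin n) 𝕜) (m : ℕ) :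
    Matrix (Fin (n - m)) (Fin (n - m)) 𝕜 :=
  M.submatrix (Fin.castLE (Nat.sub_le n m)) (Fin.castLE (Nat.sub_le n m))

/-- `U` is a random element of `U(n)` (for `𝕜 = ℂ`) or `O(n)` (for `𝕜 = ℝ`) whose law is the Haar
probability measure and which is independent of `lam`. -/
structure IsIndepHaar {Ω : Type*} [MeasurableSpace Ω] (μ : Measure Ω) {n : ℕ} {𝕜 : Type*}
    [RCLike 𝕜] (lam : Ω → Fin n → ℝ) (U : Ω → Matrix.unitaryGroup (Fin n) 𝕜) : Prop where
  aemeasurable : AEMeasurable U μ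
  isHaar : (μ.map U).IsHaarMeasure
  indep : IndepFun lam U μ

end

/-! ### Characteristic polynomials of conjugated diagonal matrices and their minors. -/

section Algebra

variable {𝕜 : Type*} [RCLike 𝕜]

/-! For (i), equal weights turn `weightedDerivative` into a multiple of the derivative. Since every
polynomial of the sequence is real-rooted, it is the product over its own root sequence, and
induction applies.

For (ii), real and complex cases are treated together over `𝕜`, with `β = finrank ℝ 𝕜`. Given `lam =
x`, both sequences are Markov chains with the same kernel. The kernel for one step: by cofactors,
removing the last row and column of `U* Diag(x) U` gives the `weightedDerivative` with weights `‖U j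
last‖ ^ 2` (`charpoly_minor_conjDiag`). For Haar `U` these weights are Dirichlet, because a Gaussian
vector is unitarily invariant and its squared moduli are independent Gamma variables
(`lintegral_dirichletMeasure_eq_lintegral_haarUnitary`). The Markov property on the matrix side:
replacing `U` by `U * Diag(V, 1)`, with `V` an independent Haar matrix of size `n - m`, preserves
the law of `U` and the characteristic polynomials of all blocks of size at least `n - m`, while the
block of size `n - m` is conjugated by the fresh `V` (`lintegral_charpoly_topLeftMinor_eq_update`).
`lintegral_eq_of_lintegral_update` then compares the chains by induction on their length, and Fubini
integrates over `lam`. -/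

theorem Matrix.charmatrix_submatrix_of_injective {R m n : Type*} [CommRing R] [Fintype m] [Fintype n]
    [DecidableEq m] [DecidableEq n] (A : Matrix n n R) {f : m → n} (hf : Function.Injective f) :
    (A.submatrix f f).charmatrix = A.charmatrix.submatrix f f := by
  ext1 i j
  by_cases h : i = j
  · subst h; simp
  · simp [h, hf.eq_iff]

theorem Matrix.charpoly_submatrix_castSucc {R : Type*} [CommRing R] {e : ℕ}
    (A : Matrix (Fin (e + 1)) (Fin (e + 1)) R) :
    (A.submatrix Fin.castSucc Fin.castSucc).charpoly =
      A.charmatrix.adjugate (Fin.last e) (Fin.last e) := by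
  rw [Matrix.adjugate_fin_succ_eq_det_submatrix, Matrix.charpoly,
    Matrix.charmatrix_submatrix_of_injective A (Fin.castSucc_injective e)]
  rw [← two_mul, pow_mul]
  simp

/-- Unitarity lets the scalar matrix `X` be written as `U* X U`, so the conjugation factors out. -/
theorem charmatrix_conjDiag {d : ℕ} (x : Fin d → ℝ) (U : Matrix.unitaryGroup (Fin d) 𝕜) :
    (conjDiag x U).charmatrix =
      (star (U : Matrix (Fin d) (Fin d) 𝕜)).map C *
        Matrix.diagonal (fun j => X - C ((x j : ℝ) : 𝕜)) *
          (U : Matrix (Fin d) (Fin d) 𝕜).map C := by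
  have h1 : (star (U : Matrix (Fin d) (Fin d) 𝕜)).map (C : 𝕜 →+* 𝕜[X]) *
      (U : Matrix (Fin d) (Fin d) 𝕜).map (C : 𝕜 →+* 𝕜[X]) = 1 := by
    rw [← Matrix.map_mul, Matrix.UnitaryGroup.star_mul_self]
    simp
  have h2 : Matrix.diagonal (fun j => X - C ((x j : ℝ) : 𝕜)) =
      Matrix.scalar (Fin d) (X : 𝕜[X]) -
        (Matrix.diagonal fun j => ((x j : ℝ) : 𝕜)).map (C : 𝕜 →+* 𝕜[X]) := by
    rw [Matrix.diagonal_map (map_zero _), Matrix.scalar_apply, Matrix.diagonal_sub]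
  rw [h2, mul_sub, sub_mul, ← Matrix.map_mul, ← Matrix.map_mul,
    ← (Matrix.scalar_commute X (Commute.all X) _).eq, mul_assoc, h1, mul_one]
  rfl

theorem charpoly_conjDiag {d : ℕ} (x : Fin d → ℝ) (U : Matrix.unitaryGroup (Fin d) 𝕜) :
    (conjDiag x U).charpoly = (polyOfRoots x).map (algebraMap ℝ 𝕜) := by
  have h1 : (star (U : Matrix (Fin d) (Fin d) 𝕜)).map (C : 𝕜 →+* 𝕜[X]) *
      (U : Matrix (Fin d) (Fin d) 𝕜).map (C : 𝕜 →+* 𝕜[X]) = 1 := by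
    rw [← Matrix.map_mul, Matrix.UnitaryGroup.star_mul_self]
    simp
  have h2 := congrArg Matrix.det h1
  rw [Matrix.det_mul, Matrix.det_one] at h2
  rw [Matrix.charpoly, charmatrix_conjDiag, Matrix.det_mul, Matrix.det_mul, mul_right_comm, h2,
    one_mul, Matrix.det_diagonal, polyOfRoots, Polynomial.map_prod]
  simp

/-- The minor is the last diagonal entry of an adjugate. The adjugate reverses products, and that of
a unitary matrix is its determinant times its inverse; the two determinants multiply to one. What
remains is `U* adj(X - Diag(x)) U`, whose last diagonal entry is the weighted sum. -/
theorem charpoly_minor_conjDiag {e : ℕ} (x : Fin (e + 1) → ℝ)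
    (U : Matrix.unitaryGroup (Fin (e + 1)) 𝕜) :
    ((conjDiag x U).submatrix Fin.castSucc Fin.castSucc).charpoly =
      (weightedDerivative x fun j =>
        ‖(U : Matrix (Fin (e + 1)) (Fin (e + 1)) 𝕜) j (Fin.last e)‖ ^ 2).map (algebraMap ℝ 𝕜) := by
  set u : Matrix (Fin (e + 1)) (Fin (e + 1)) 𝕜[X] :=
    (U : Matrix (Fin (e + 1)) (Fin (e + 1)) 𝕜).map (C : 𝕜 →+* 𝕜[X]) with hu
  set v : Matrix (Fin (e + 1)) (Fin (e + 1)) 𝕜[X] :=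
    (star (U : Matrix (Fin (e + 1)) (Fin (e + 1)) 𝕜)).map (C : 𝕜 →+* 𝕜[X]) with hv
  have h1 : v * u = 1 := by
    rw [hu, hv, ← Matrix.map_mul, Matrix.UnitaryGroup.star_mul_self]
    simp
  have hdet := congrArg Matrix.det h1
  rw [Matrix.det_mul, Matrix.det_one] at hdet
  have hau : u.adjugate = u.det • v := by
    calc u.adjugate = (v * u) * u.adjugate := by rw [h1, one_mul]
      _ = u.det • v := by rw [mul_assoc, Matrix.mul_adjugate, Matrix.mul_smul, mul_one]
  have hav : v.adjugate = v.det • u := by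
    calc v.adjugate = v.adjugate * (v * u) := by rw [h1, mul_one]
      _ = v.det • u := by rw [← mul_assoc, Matrix.adjugate_mul, Matrix.smul_mul, one_mul]
  rw [Matrix.charpoly_submatrix_castSucc, charmatrix_conjDiag, ← hu, ← hv,
    Matrix.adjugate_mul_distrib, Matrix.adjugate_mul_distrib, hau, hav, Matrix.adjugate_diagonal]
  rw [Matrix.mul_smul, Matrix.smul_mul, Matrix.mul_smul, smul_smul, mul_comm u.det, hdet, one_smul,
    ← mul_assoc, Matrix.mul_apply, weightedDerivative, Polynomial.map_sum]
  refine Finset.sum_congr rfl fun j _ => ?_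
  rw [Matrix.mul_diagonal, Polynomial.map_mul, Polynomial.map_prod, hu, hv, mul_right_comm]
  congr 1
  · simp only [Matrix.map_apply, Matrix.star_apply, Polynomial.map_C]
    rw [← C_mul, RCLike.star_def, RCLike.conj_mul]
    simp
  · refine Finset.prod_congr rfl fun i _ => ?_
    simp

theorem exists_unitary_last_column {e : ℕ} (v : Fin (e + 1) → 𝕜) (hv : ∑ j, ‖v j‖ ^ 2 = 1) :
    ∃ U : Matrix.unitaryGroup (Fin (e + 1)) 𝕜,
      ∀ j, (U : Matrix (Fin (e + 1)) (Fin (e + 1)) 𝕜) j (Fin.last e) = v j := by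
  let w : EuclideanSpace 𝕜 (Fin (e + 1)) := WithLp.toLp 2 v
  have hw : ‖w‖ = 1 := by
    rw [EuclideanSpace.norm_eq]
    simpa [w] using hv
  obtain ⟨b, hb⟩ := Orthonormal.exists_orthonormalBasis_extension_of_card_eq (𝕜 := 𝕜)
    (E := EuclideanSpace 𝕜 (Fin (e + 1))) (ι := Fin (e + 1)) (by simp)
    (v := fun _ => w) (s := {Fin.last e}) (by
      constructor
      · intro i; simpa using hw
      · intro i j hij; exact absurd (Subsingleton.elim i j) hij)
  refine ⟨⟨_, OrthonormalBasis.toMatrix_orthonormalBasis_mem_unitary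
    (EuclideanSpace.basisFun (Fin (e + 1)) 𝕜) b⟩, fun j => ?_⟩
  simp [Module.Basis.toMatrix_apply, hb (Fin.last e) rfl, w]

theorem isHermitian_conjDiag {d : ℕ} (x : Fin d → ℝ) (U : Matrix.unitaryGroup (Fin d) 𝕜) :
    (conjDiag x U).IsHermitian := by
  rw [Matrix.IsHermitian, ← Matrix.star_eq_conjTranspose, conjDiag, star_mul, star_mul, star_star,
    Matrix.star_eq_conjTranspose (Matrix.diagonal _), Matrix.diagonal_conjTranspose, mul_assoc]
  congr 3
  ext; simp

theorem conjDiag_mul {d : ℕ} (x : Fin d → ℝ) (U V : Matrix.unitaryGroup (Fin d) 𝕜) :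
    conjDiag x (U * V) =
      star (V : Matrix (Fin d) (Fin d) 𝕜) * conjDiag x U * (V : Matrix (Fin d) (Fin d) 𝕜) := by
  simp [conjDiag, star_mul, mul_assoc]

/-- The spectral theorem with nondecreasing eigenvalues. -/
theorem Matrix.IsHermitian.exists_eq_conjDiag {d : ℕ} {M : Matrix (Fin d) (Fin d) 𝕜}
    (hM : M.IsHermitian) :
    ∃ (x : Fin d → ℝ) (W : Matrix.unitaryGroup (Fin d) 𝕜), Monotone x ∧ M = conjDiag x W := by
  -- The eigenvalues are reordered by `σ`, and the rows of the adjoint of the eigenvector matrix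
  -- with them.
  set σ := Tuple.sort hM.eigenvalues with hσ
  let E : Matrix (Fin d) (Fin d) 𝕜 := hM.eigenvectorUnitary
  have hE : (star E).submatrix σ id ∈ Matrix.unitaryGroup (Fin d) 𝕜 := by
    have h0 : star ((star E).submatrix σ id) = E.submatrix id σ := by
      rw [Matrix.star_eq_conjTranspose, Matrix.conjTranspose_submatrix,
        ← Matrix.star_eq_conjTranspose, star_star]
    rw [Matrix.mem_unitaryGroup_iff, h0]
    have : (star E).submatrix σ id * E.submatrix id σ = ((star E) * E).submatrix σ σ :=
      Matrix.submatrix_mul_equiv (star E) E σ (Equiv.refl _) σ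
    rw [this, Matrix.UnitaryGroup.star_mul_self]
    simp
  refine ⟨hM.eigenvalues ∘ σ, ⟨_, hE⟩, Tuple.monotone_sort _, ?_⟩
  have h := hM.spectral_theorem
  rw [Unitary.conjStarAlgAut_apply] at h
  rw [conjDiag]
  simp only
  have h2 : (Matrix.diagonal fun j => (((hM.eigenvalues ∘ σ) j : ℝ) : 𝕜)) =
    (Matrix.diagonal (RCLike.ofReal ∘ hM.eigenvalues : Fin d → 𝕜)).submatrix σ σ := by
    rw [Matrix.submatrix_diagonal_equiv]; rfl
  rw [h2, Matrix.star_eq_conjTranspose, Matrix.conjTranspose_submatrix,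
      ← Matrix.star_eq_conjTranspose, star_star]
  rw [Matrix.submatrix_mul_equiv E _ id σ σ, Matrix.submatrix_mul_equiv _ _ id σ id]
  rw [Matrix.submatrix_id_id]
  exact h

theorem roots_polyOfRoots {d : ℕ} (y : Fin d → ℝ) :
    (polyOfRoots y).roots = Multiset.map y Finset.univ.val := by
  rw [← Polynomial.roots_multiset_prod_X_sub_C (Multiset.map y Finset.univ.val), Multiset.map_map]
  rfl

theorem sortedRoots_polyOfRoots {d : ℕ} {y : Fin d → ℝ} (hy : Monotone y) :
    sortedRoots d (polyOfRoots y) = y := by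
  have h : (polyOfRoots y).roots.sort (· ≤ ·) = List.ofFn y := by
    rw [roots_polyOfRoots, Fin.univ_val_map]
    refine List.Perm.eq_of_pairwise' (r := (· ≤ ·)) (Multiset.pairwise_sort _ _) ?_ ?_
    · exact List.sortedLE_iff_pairwise.1 hy.sortedLE_ofFn
    · exact Multiset.coe_eq_coe.1 (Multiset.sort_eq _ _)
  funext j
  simp [sortedRoots, h]

theorem map_polyOfRoots_injOn {d : ℕ} {x y : Fin d → ℝ} (hx : Monotone x) (hy : Monotone y)
    (h : (polyOfRoots x).map (algebraMap ℝ 𝕜) = (polyOfRoots y).map (algebraMap ℝ 𝕜)) : x = y := by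
  have := Polynomial.map_injective _ (algebraMap ℝ 𝕜).injective h
  rw [← sortedRoots_polyOfRoots hx, this, sortedRoots_polyOfRoots hy]

/-- Real-rootedness: the vector `√(w j)` is the last column of some orthogonal matrix, so the
polynomial is the characteristic polynomial of a symmetric matrix. -/
theorem exists_weightedDerivative_eq_polyOfRoots {d e : ℕ} (hd : d = e + 1) (x w : Fin d → ℝ)
    (hw0 : ∀ j, 0 ≤ w j) (hw1 : ∑ j, w j = 1) :
    ∃ y : Fin e → ℝ, Monotone y ∧ weightedDerivative x w = polyOfRoots y := by
  subst hd
  obtain ⟨U, hU⟩ := exists_unitary_last_column (𝕜 := ℝ) (fun j => √(w j)) (by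
    simpa [Real.sq_sqrt, hw0] using hw1)
  have h := charpoly_minor_conjDiag x U
  have hH : ((conjDiag x U).submatrix Fin.castSucc Fin.castSucc).IsHermitian :=
    (isHermitian_conjDiag x U).submatrix _
  obtain ⟨y, W, hy, hyW⟩ := hH.exists_eq_conjDiag
  refine ⟨y, hy, ?_⟩
  rw [hyW, charpoly_conjDiag] at h
  have h2 := Polynomial.map_injective _ (algebraMap ℝ ℝ).injective h
  rw [h2]
  congr 1
  funext j
  simp [hU, Real.sq_sqrt, hw0]

end Algebra

/-! ### The derivative formula, and block embeddings of unitary groups. -/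

section Blocks

variable {𝕜 : Type*} [RCLike 𝕜]

/-- Real-rootedness propagates along the construction, so the default value in `sortedRoots` never
enters. -/
theorem rootSeq_monotone_and_polySeq_eq {n : ℕ} (lam : Fin n → ℝ)
    (rho : (m : ℕ) → Fin (n - m) → ℝ) (hlam : Monotone lam)
    (h0 : ∀ m < n, ∀ j, 0 ≤ rho m j) (h1 : ∀ m < n, ∑ j, rho m j = 1) (m : ℕ) (hm : m ≤ n) :
    Monotone (rootSeq lam rho m) ∧ polySeq lam rho m = polyOfRoots (rootSeq lam rho m) := by
  induction m with
  | zero => exact ⟨hlam, rfl⟩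
  | succ m ih =>
    obtain ⟨y, hy, h⟩ := exists_weightedDerivative_eq_polyOfRoots (d := n - m) (e := n - (m + 1))
      (by omega) (rootSeq lam rho m) (rho m) (h0 m hm) (h1 m hm)
    have hr : rootSeq lam rho (m + 1) = y := by
      rw [rootSeq, h, sortedRoots_polyOfRoots hy]
    rw [hr]
    exact ⟨hy, by rw [polySeq, h]⟩

theorem weightedDerivative_const {d : ℕ} (x : Fin d → ℝ) (c : ℝ) :
    weightedDerivative x (fun _ => c) = C c * derivative (polyOfRoots x) := by
  rw [polyOfRoots, Polynomial.derivative_prod_finset, weightedDerivative, Finset.mul_sum]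
  refine Finset.sum_congr rfl fun j _ => ?_
  simp

theorem polySeq_eq_iterate_derivative {n : ℕ} (lam : Fin n → ℝ)
    (rho : (m : ℕ) → Fin (n - m) → ℝ) (hlam : Monotone lam)
    (hrho : ∀ m < n, ∀ j, rho m j = 1 / ((n : ℝ) - m)) (m : ℕ) (hm : m ≤ n) :
    polySeq lam rho m = C (((n - m).factorial : ℝ) / (n.factorial : ℝ)) *
      derivative^[m] (polySeq lam rho 0) := by
  have hpos : ∀ m < n, (0 : ℝ) < (n : ℝ) - m := fun m h => by
    have : (m : ℝ) < n := by exact_mod_cast h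
    linarith
  have h0 : ∀ m < n, ∀ j, 0 ≤ rho m j := fun m h j => by
    rw [hrho m h]; exact (one_div_pos.2 (hpos m h)).le
  have h1 : ∀ m < n, ∑ j, rho m j = 1 := fun m h => by
    simp only [hrho m h, Finset.sum_const, Finset.card_univ, Fintype.card_fin, nsmul_eq_mul]
    rw [Nat.cast_sub h.le, mul_one_div_cancel (hpos m h).ne']
  induction m with
  | zero =>
    have : (n.factorial : ℝ) ≠ 0 := by exact_mod_cast n.factorial_ne_zero
    simp [this]
  | succ m ih =>
    have hm' : m < n := hm
    have hc : rho m = fun _ => 1 / ((n : ℝ) - m) := funext (hrho m hm')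
    have hs : polySeq lam rho (m + 1) = weightedDerivative (rootSeq lam rho m) (rho m) := rfl
    rw [hs, hc, weightedDerivative_const,
      ← (rootSeq_monotone_and_polySeq_eq lam rho hlam h0 h1 m hm'.le).2, ih hm'.le,
      Function.iterate_succ_apply', derivative_C_mul, ← mul_assoc, ← C_mul]
    congr 2
    -- The extra factor `n - m` of the factorial cancels the weight `1 / (n - m)`.
    have hf : ((n - m).factorial : ℝ) = ((n : ℝ) - m) * ((n - (m + 1)).factorial : ℝ) := by
      obtain ⟨k, rfl⟩ := Nat.exists_eq_add_of_lt hm'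
      have e1 : m + k + 1 - m = k + 1 := by omega
      have e2 : m + k + 1 - (m + 1) = k := by omega
      rw [e1, e2, Nat.factorial_succ]
      push_cast; ring
    rw [hf, ← mul_div_assoc, ← mul_assoc, one_div_mul_cancel (hpos m hm').ne', one_mul]

/-- The first `k` columns of the identity matrix of size `n`. -/
noncomputable def inclMatrix (𝕜 : Type*) [RCLike 𝕜] {k n : ℕ} (h : k ≤ n) :
    Matrix (Fin n) (Fin k) 𝕜 :=
  (1 : Matrix (Fin n) (Fin n) 𝕜).submatrix id (Fin.castLE h)

/-- Writing a block as the compression `J* M J` replaces index bookkeeping by matrix algebra based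
on `J* J = 1`. -/
theorem conjTranspose_inclMatrix_mul_mul {k n : ℕ} (h : k ≤ n) (M : Matrix (Fin n) (Fin n) 𝕜) :
    (inclMatrix 𝕜 h).conjTranspose * M * inclMatrix 𝕜 h =
      M.submatrix (Fin.castLE h) (Fin.castLE h) := by
  ext i j
  simp [inclMatrix, Matrix.mul_apply, Matrix.one_apply, Finset.sum_ite_eq]

theorem conjTranspose_inclMatrix_mul {k n : ℕ} (h : k ≤ n) :
    (inclMatrix 𝕜 h).conjTranspose * inclMatrix 𝕜 h = 1 := by
  have := conjTranspose_inclMatrix_mul_mul h (1 : Matrix (Fin n) (Fin n) 𝕜)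
  rw [Matrix.mul_one, Matrix.submatrix_one _ (Fin.castLE_injective h)] at this
  exact this

theorem inclMatrix_mul {d k n : ℕ} (h : d ≤ k) (h' : k ≤ n) :
    inclMatrix 𝕜 h' * inclMatrix 𝕜 h = inclMatrix 𝕜 (h.trans h') := by
  ext i j
  simp [inclMatrix, Matrix.mul_apply, Matrix.one_apply]

theorem inclMatrix_self {n : ℕ} : inclMatrix 𝕜 (le_refl n) = 1 := by
  ext i j; rfl

/-- The block diagonal matrix `Diag(V, 1)` of size `n`. -/
noncomputable def extendMatrix {d n : ℕ} (h : d ≤ n) (V : Matrix (Fin d) (Fin d) 𝕜) :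
    Matrix (Fin n) (Fin n) 𝕜 :=
  inclMatrix 𝕜 h * V * (inclMatrix 𝕜 h).conjTranspose +
    (1 - inclMatrix 𝕜 h * (inclMatrix 𝕜 h).conjTranspose)

theorem extendMatrix_mul {d n : ℕ} (h : d ≤ n) (V W : Matrix (Fin d) (Fin d) 𝕜) :
    extendMatrix h V * extendMatrix h W = extendMatrix h (V * W) := by
  have hJ := conjTranspose_inclMatrix_mul (𝕜 := 𝕜) h
  simp only [extendMatrix]
  generalize inclMatrix 𝕜 h = J at hJ
  have a : ∀ A : Matrix (Fin d) (Fin n) 𝕜, J.conjTranspose * (J * A) = A := fun A => by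
    rw [← Matrix.mul_assoc, hJ, Matrix.one_mul]
  simp only [Matrix.add_mul, Matrix.mul_add, Matrix.sub_mul, Matrix.mul_sub, Matrix.one_mul,
    Matrix.mul_one, Matrix.mul_assoc, a]
  abel

theorem extendMatrix_one {d n : ℕ} (h : d ≤ n) :
    extendMatrix h (1 : Matrix (Fin d) (Fin d) 𝕜) = 1 := by
  simp [extendMatrix]

theorem conjTranspose_extendMatrix {d n : ℕ} (h : d ≤ n) (V : Matrix (Fin d) (Fin d) 𝕜) :
    (extendMatrix h V).conjTranspose = extendMatrix h V.conjTranspose := by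
  simp [extendMatrix, Matrix.conjTranspose_mul, Matrix.mul_assoc]

/-- This intertwining relation makes conjugation by `Diag(V, 1)` commute with passing to a block of
size `k ≥ d`. -/
theorem extendMatrix_mul_inclMatrix {d k n : ℕ} (h : d ≤ k) (h' : k ≤ n)
    (V : Matrix (Fin d) (Fin d) 𝕜) :
    extendMatrix (h.trans h') V * inclMatrix 𝕜 h' = inclMatrix 𝕜 h' * extendMatrix h V := by
  have hJ := conjTranspose_inclMatrix_mul (𝕜 := 𝕜) h'
  simp only [extendMatrix, ← inclMatrix_mul h h', Matrix.conjTranspose_mul]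
  simp only [Matrix.add_mul, Matrix.mul_add, Matrix.sub_mul, Matrix.mul_sub, Matrix.one_mul,
    Matrix.mul_one, Matrix.mul_assoc, hJ]

theorem extendMatrix_self {d : ℕ} (V : Matrix (Fin d) (Fin d) 𝕜) :
    extendMatrix le_rfl V = V := by
  simp [extendMatrix, inclMatrix_self]

theorem extendMatrix_mem_unitaryGroup {d n : ℕ} (h : d ≤ n) (V : Matrix.unitaryGroup (Fin d) 𝕜) :
    extendMatrix h (V : Matrix (Fin d) (Fin d) 𝕜) ∈ Matrix.unitaryGroup (Fin n) 𝕜 := by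
  rw [Matrix.mem_unitaryGroup_iff, Matrix.star_eq_conjTranspose, conjTranspose_extendMatrix,
    extendMatrix_mul, ← Matrix.star_eq_conjTranspose, Matrix.mem_unitaryGroup_iff.1 V.2,
    extendMatrix_one]

/-- The embedding `V ↦ Diag(V, 1)` of unitary groups. -/
noncomputable def extendUnitary {d n : ℕ} (h : d ≤ n) (V : Matrix.unitaryGroup (Fin d) 𝕜) :
    Matrix.unitaryGroup (Fin n) 𝕜 :=
  ⟨extendMatrix h (V : Matrix (Fin d) (Fin d) 𝕜), extendMatrix_mem_unitaryGroup h V⟩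

theorem submatrix_conjDiag_mul_extendUnitary {d k n : ℕ} (h : d ≤ k) (h' : k ≤ n)
    (x : Fin n → ℝ) (U : Matrix.unitaryGroup (Fin n) 𝕜) (V : Matrix.unitaryGroup (Fin d) 𝕜) :
    (conjDiag x (U * extendUnitary (h.trans h') V)).submatrix (Fin.castLE h') (Fin.castLE h') =
      star (extendUnitary h V : Matrix (Fin k) (Fin k) 𝕜) *
        (conjDiag x U).submatrix (Fin.castLE h') (Fin.castLE h') *
          (extendUnitary h V : Matrix (Fin k) (Fin k) 𝕜) := by
  have e := extendMatrix_mul_inclMatrix h h' (V : Matrix (Fin d) (Fin d) 𝕜)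
  have e' := congrArg Matrix.conjTranspose e
  rw [Matrix.conjTranspose_mul, Matrix.conjTranspose_mul] at e'
  rw [conjDiag_mul, ← conjTranspose_inclMatrix_mul_mul, ← conjTranspose_inclMatrix_mul_mul,
    Matrix.star_eq_conjTranspose, Matrix.star_eq_conjTranspose]
  simp only [extendUnitary, Matrix.mul_assoc, e]
  simp only [← Matrix.mul_assoc, e']

/-- A block at least as large as `V` is merely conjugated by a unitary matrix. -/
theorem charpoly_submatrix_conjDiag_mul_extendUnitary {d k n : ℕ} (h : d ≤ k) (h' : k ≤ n)
    (x : Fin n → ℝ) (U : Matrix.unitaryGroup (Fin n) 𝕜) (V : Matrix.unitaryGroup (Fin d) 𝕜) :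
    ((conjDiag x (U * extendUnitary (h.trans h') V)).submatrix
        (Fin.castLE h') (Fin.castLE h')).charpoly =
      ((conjDiag x U).submatrix (Fin.castLE h') (Fin.castLE h')).charpoly := by
  rw [submatrix_conjDiag_mul_extendUnitary h h', Matrix.charpoly_mul_comm, ← mul_assoc,
    Matrix.mem_unitaryGroup_iff.1 (extendUnitary h V).2, one_mul]

/-- A block smaller than `V` is cut out of the block of size `d`, which is conjugated by `V` itself;
this is where fresh randomness enters. -/
theorem submatrix_conjDiag_mul_extendUnitary_of_le {k d n : ℕ} (h : k ≤ d) (h' : d ≤ n)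
    (x : Fin n → ℝ) (U : Matrix.unitaryGroup (Fin n) 𝕜) (V : Matrix.unitaryGroup (Fin d) 𝕜) :
    (conjDiag x (U * extendUnitary h' V)).submatrix
        (Fin.castLE (h.trans h')) (Fin.castLE (h.trans h')) =
      (star (V : Matrix (Fin d) (Fin d) 𝕜) *
        (conjDiag x U).submatrix (Fin.castLE h') (Fin.castLE h') *
          (V : Matrix (Fin d) (Fin d) 𝕜)).submatrix (Fin.castLE h) (Fin.castLE h) := by
  have e := submatrix_conjDiag_mul_extendUnitary le_rfl h' x U V
  simp only [extendUnitary, extendMatrix_self] at e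
  rw [← e]
  rfl

end Blocks

/-! ### Measurability of coefficients, roots and characteristic polynomials. -/

section Measurability

section PolynomialMeasurability

variable {α R : Type*} [MeasurableSpace α] [MeasurableSpace R]

theorem Polynomial.measurable_coeff [Semiring R] (i : ℕ) :
    Measurable fun p : R[X] => p.coeff i :=
  (measurable_pi_apply i).comp (comap_measurable fun (p : R[X]) (i : ℕ) => p.coeff i)

theorem Polynomial.measurable_of_coeff [Semiring R] {f : α → R[X]}
    (h : ∀ i, Measurable fun a => (f a).coeff i) : Measurable f :=
  measurable_comap_iff.2 (measurable_pi_lambda _ h)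

instance Polynomial.measurableAdd₂ [Semiring R] [MeasurableAdd₂ R] : MeasurableAdd₂ R[X] :=
  ⟨Polynomial.measurable_of_coeff fun i => by
    simp only [Polynomial.coeff_add]
    exact ((Polynomial.measurable_coeff i).comp measurable_fst).add
      ((Polynomial.measurable_coeff i).comp measurable_snd)⟩

instance Polynomial.measurableMul₂ [Semiring R] [MeasurableAdd₂ R] [MeasurableMul₂ R] :
    MeasurableMul₂ R[X] :=
  ⟨Polynomial.measurable_of_coeff fun i => by
    simp only [Polynomial.coeff_mul]
    exact Finset.measurable_fun_sum _ fun p _ =>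
      ((Polynomial.measurable_coeff _).comp measurable_fst).mul
        ((Polynomial.measurable_coeff _).comp measurable_snd)⟩

theorem Polynomial.measurable_C [Semiring R] : Measurable (C : R → R[X]) :=
  Polynomial.measurable_of_coeff fun i => by
    by_cases h : i = 0
    · subst h; simpa using measurable_id'
    · simp [Polynomial.coeff_C, h]

theorem Measurable.polynomial_map [Semiring R] {S : Type*} [Semiring S] [MeasurableSpace S]
    {φ : R →+* S} (hφ : Measurable φ) {f : α → R[X]} (hf : Measurable f) :
    Measurable fun a => (f a).map φ :=
  Polynomial.measurable_of_coeff fun i => by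
    simp only [Polynomial.coeff_map]
    exact hφ.comp ((Polynomial.measurable_coeff i).comp hf)

theorem Polynomial.measurable_X_sub_C [Ring R] [MeasurableAdd₂ R] [MeasurableNeg R] {f : α → R}
    (hf : Measurable f) : Measurable fun a => X - C (f a) := by
  have h : (fun a => X - C (f a)) = fun a => X + C (-f a) := by
    funext a; rw [C_neg, sub_eq_add_neg]
  rw [h]
  exact measurable_const.add (Polynomial.measurable_C.comp hf.neg)

theorem Matrix.measurable_charpoly [CommRing R] [MeasurableAdd₂ R] [MeasurableMul₂ R]
    [MeasurableNeg R] {k : ℕ} {A : α → Matrix (Fin k) (Fin k) R}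
    (hA : ∀ i j, Measurable fun a => A a i j) : Measurable fun a => (A a).charpoly := by
  have h : ∀ i j, Measurable fun a => (A a).charmatrix i j := fun i j => by
    by_cases hij : i = j
    · subst hij
      simp only [Matrix.charmatrix_apply_eq]
      exact Polynomial.measurable_X_sub_C (hA i i)
    · have : (fun a => (A a).charmatrix i j) = fun a => C (-(A a i j)) := by
        funext a; rw [Matrix.charmatrix_apply_ne _ _ _ hij, C_neg]
      rw [this]
      exact Polynomial.measurable_C.comp (hA i j).neg
  simp only [Matrix.charpoly, Matrix.det_apply']
  have hprod : ∀ σ : Equiv.Perm (Fin k), Measurable fun a => ∏ i, (A a).charmatrix (σ i) i :=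
    fun σ => Finset.measurable_fun_prod _ fun i _ => h _ _
  exact Finset.measurable_fun_sum _ fun σ _ => measurable_const.mul (hprod σ)

theorem measurable_polyOfRoots {d : ℕ} :
    Measurable (polyOfRoots : (Fin d → ℝ) → ℝ[X]) := by
  unfold polyOfRoots
  exact Finset.measurable_fun_prod _ fun i _ =>
    Polynomial.measurable_X_sub_C (measurable_pi_apply i)

theorem Measurable.weightedDerivative {d : ℕ} {x w : α → Fin d → ℝ} (hx : Measurable x)
    (hw : Measurable w) : Measurable fun a => weightedDerivative (x a) (w a) := by
  unfold _root_.weightedDerivative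
  have hprod : ∀ j, Measurable fun a => ∏ i ∈ Finset.univ.erase j, (X - C (x a i)) := fun j =>
    Finset.measurable_fun_prod _ fun i _ =>
      Polynomial.measurable_X_sub_C ((measurable_pi_apply i).comp hx)
  exact Finset.measurable_fun_sum _ fun j _ =>
    (Polynomial.measurable_C.comp ((measurable_pi_apply j).comp hw)).mul (hprod j)

end PolynomialMeasurability

variable {𝕜 : Type*} [RCLike 𝕜] [MeasurableSpace 𝕜] [BorelSpace 𝕜]

theorem measurable_algebraMap_real : Measurable (algebraMap ℝ 𝕜) :=
  (RCLike.continuous_ofReal (K := 𝕜)).measurable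

/-- On polynomials with real roots, the sorted vector of roots is a measurable function of the
coefficients. -/
theorem exists_measurable_roots (𝕜 : Type*) [RCLike 𝕜] [MeasurableSpace 𝕜] [BorelSpace 𝕜] (d : ℕ) :
    ∃ r : 𝕜[X] → Fin d → ℝ, Measurable r ∧
      ∀ x, Monotone x → r ((polyOfRoots x).map (algebraMap ℝ 𝕜)) = x := by
  have hclosed : IsClosed {x : Fin d → ℝ | Monotone x} := by
    simp only [Monotone, Set.ofPred_forall]
    exact isClosed_iInter fun i => isClosed_iInter fun j => isClosed_iInter fun _ =>
      isClosed_le (continuous_apply i) (continuous_apply j)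
  have : StandardBorelSpace {x : Fin d → ℝ // Monotone x} :=
    hclosed.measurableSet.standardBorel
  let F : {x : Fin d → ℝ // Monotone x} → ℕ → 𝕜 :=
    fun x i => ((polyOfRoots x.1).map (algebraMap ℝ 𝕜)).coeff i
  have hF : Measurable F := measurable_pi_lambda _ fun i =>
    (Polynomial.measurable_coeff i).comp (Measurable.polynomial_map measurable_algebraMap_real
      (measurable_polyOfRoots.comp measurable_subtype_coe))
  have hinj : Function.Injective F := fun x y h =>
    Subtype.ext (map_polyOfRoots_injOn (𝕜 := 𝕜) x.2 y.2 (Polynomial.ext fun i => congrFun h i))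
  -- Lusin–Souslin: an injective measurable map on a standard Borel space has a measurable inverse
  -- on its range, which is extended to all coefficient sequences.
  obtain ⟨g, hg, hgF⟩ := (hF.measurableEmbedding hinj).exists_measurable_extend
    measurable_subtype_coe fun _ => ⟨(0 : Fin d → ℝ)⟩
  refine ⟨fun p => g fun i => p.coeff i,
    hg.comp (measurable_pi_lambda _ Polynomial.measurable_coeff), fun x hx => ?_⟩
  exact congrFun hgF ⟨x, hx⟩

/-- A measurable version of the nondecreasing sequence of the roots. -/
noncomputable def measurableRoots (𝕜 : Type*) [RCLike 𝕜] [MeasurableSpace 𝕜] [BorelSpace 𝕜]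
    (d : ℕ) : 𝕜[X] → Fin d → ℝ :=
  (exists_measurable_roots 𝕜 d).choose

theorem measurable_measurableRoots (d : ℕ) : Measurable (measurableRoots 𝕜 d) :=
  (exists_measurable_roots 𝕜 d).choose_spec.1

theorem measurableRoots_map_polyOfRoots {d : ℕ} {x : Fin d → ℝ} (hx : Monotone x) :
    measurableRoots 𝕜 d ((polyOfRoots x).map (algebraMap ℝ 𝕜)) = x :=
  (exists_measurable_roots 𝕜 d).choose_spec.2 x hx

/-- One step of the construction, from a polynomial of degree `d` and a vector of weights. -/
noncomputable def polyStep {d : ℕ} (p : 𝕜[X]) (w : Fin d → ℝ) : 𝕜[X] :=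
  (weightedDerivative (measurableRoots 𝕜 d p) w).map (algebraMap ℝ 𝕜)

theorem Measurable.polyStep {α : Type*} [MeasurableSpace α] {d : ℕ} {p : α → 𝕜[X]}
    {w : α → Fin d → ℝ} (hp : Measurable p) (hw : Measurable w) :
    Measurable fun a => polyStep (p a) (w a) :=
  Measurable.polynomial_map measurable_algebraMap_real
    (Measurable.weightedDerivative ((measurable_measurableRoots d).comp hp) hw)

/-- The sequence `polySeq`, with `measurableRoots` in place of `sortedRoots`. -/
noncomputable def polyChain (𝕜 : Type*) [RCLike 𝕜] [MeasurableSpace 𝕜] [BorelSpace 𝕜] {n : ℕ}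
    (lam : Fin n → ℝ) (rho : (m : ℕ) → Fin (n - m) → ℝ) : ℕ → 𝕜[X]
  | 0 => (polyOfRoots lam).map (algebraMap ℝ 𝕜)
  | m + 1 => polyStep (polyChain 𝕜 lam rho m) (rho m)

theorem measurable_polyChain {n : ℕ} (m : ℕ) :
    Measurable fun q : (Fin n → ℝ) × ((m : ℕ) → Fin (n - m) → ℝ) =>
      polyChain 𝕜 q.1 q.2 m := by
  induction m with
  | zero =>
    exact Measurable.polynomial_map measurable_algebraMap_real
      (measurable_polyOfRoots.comp measurable_fst)
  | succ m ih =>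
    exact Measurable.polyStep ih ((measurable_pi_apply m).comp measurable_snd)

theorem polyChain_congr {n : ℕ} (lam : Fin n → ℝ) {rho rho' : (m : ℕ) → Fin (n - m) → ℝ} {m : ℕ}
    (h : ∀ i < m, rho i = rho' i) : polyChain 𝕜 lam rho m = polyChain 𝕜 lam rho' m := by
  induction m with
  | zero => rfl
  | succ m ih =>
    rw [polyChain, polyChain, ih fun i hi => h i (by omega), h m (by omega)]

theorem polyChain_eq_polySeq {n : ℕ} (lam : Fin n → ℝ)
    (rho : (m : ℕ) → Fin (n - m) → ℝ) (hlam : Monotone lam)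
    (h0 : ∀ m < n, ∀ j, 0 ≤ rho m j) (h1 : ∀ m < n, ∑ j, rho m j = 1) (m : ℕ) (hm : m ≤ n) :
    polyChain 𝕜 lam rho m = (polySeq lam rho m).map (algebraMap ℝ 𝕜) := by
  induction m with
  | zero => rfl
  | succ m ih =>
    obtain ⟨h, h'⟩ := rootSeq_monotone_and_polySeq_eq lam rho hlam h0 h1 m (by omega)
    rw [polyChain, ih (by omega), h', polyStep, measurableRoots_map_polyOfRoots h]
    rfl

theorem measurable_coe_unitaryGroup {n : ℕ} (i j : Fin n) :
    Measurable fun U : Matrix.unitaryGroup (Fin n) 𝕜 => (U : Matrix (Fin n) (Fin n) 𝕜) i j :=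
  (Continuous.matrix_elem continuous_subtype_val i j).measurable

theorem Measurable.conjDiag {α : Type*} [MeasurableSpace α] {n : ℕ} {x : α → Fin n → ℝ}
    {U : α → Matrix.unitaryGroup (Fin n) 𝕜} (hx : Measurable x) (hU : Measurable U) (i j : Fin n) :
    Measurable fun a => conjDiag (x a) (U a) i j := by
  simp only [_root_.conjDiag, Matrix.mul_apply (M := star _ * _), Matrix.mul_diagonal,
    Matrix.star_apply]
  refine Finset.measurable_fun_sum _ fun k _ => Measurable.mul (Measurable.mul ?_ ?_) ?_
  · exact RCLike.continuous_conj.measurable.comp ((measurable_coe_unitaryGroup k i).comp hU)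
  · exact measurable_algebraMap_real.comp ((measurable_pi_apply k).comp hx)
  · exact (measurable_coe_unitaryGroup k j).comp hU

theorem measurable_charpoly_topLeftMinor {α : Type*} [MeasurableSpace α] {n : ℕ}
    {x : α → Fin n → ℝ} {U : α → Matrix.unitaryGroup (Fin n) 𝕜} (hx : Measurable x)
    (hU : Measurable U) (m : ℕ) :
    Measurable fun a => (topLeftMinor (conjDiag (x a) (U a)) m).charpoly :=
  Matrix.measurable_charpoly fun _ _ => hx.conjDiag hU _ _

end Measurability

/-! ### Product measures with densities. -/

theorem lintegral_fin_prod_eq_prod {X : Type*} [MeasurableSpace X] {d : ℕ} (μ : Measure X)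
    [SigmaFinite μ] {f : Fin d → X → ℝ≥0∞} (hf : ∀ i, Measurable (f i)) :
    ∫⁻ z, ∏ i, f i (z i) ∂(Measure.pi fun _ : Fin d => μ) = ∏ i, ∫⁻ x, f i x ∂μ := by
  induction d with
  | zero => simp
  | succ d ih =>
    have h := (measurePreserving_piFinSuccAbove (fun _ : Fin (d + 1) => μ) 0).symm
    have hm : Measurable fun z : Fin (d + 1) → X => ∏ i, f i (z i) :=
      Finset.measurable_fun_prod _ fun i _ => (hf i).comp (measurable_pi_apply i)
    rw [← h.lintegral_comp hm, lintegral_prod]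
    · simp only [Fin.prod_univ_succ, MeasurableEquiv.piFinSuccAbove_symm_apply,
        Fin.insertNthEquiv_zero, Fin.consEquiv_apply, Fin.cons_zero, Fin.cons_succ]
      rw [← ih fun i => hf i.succ, ← lintegral_mul_const _ (hf 0)]
      refine lintegral_congr fun x => ?_
      rw [lintegral_const_mul]
      exact Finset.measurable_fun_prod _ fun i _ => (hf _).comp (measurable_pi_apply i)
    · exact (hm.comp (MeasurableEquiv.measurable _)).aemeasurable

theorem pi_withDensity_eq {X : Type*} [MeasurableSpace X] {d : ℕ} (μ : Measure X)
    [SigmaFinite μ] {f : X → ℝ≥0∞} (hf : Measurable f) [SigmaFinite (μ.withDensity f)] :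
    (Measure.pi fun _ : Fin d => μ.withDensity f) =
      (Measure.pi fun _ : Fin d => μ).withDensity fun z => ∏ i, f (z i) := by
  refine Measure.pi_eq fun s hs => ?_
  rw [withDensity_apply _ (MeasurableSet.univ_pi hs),
    ← lintegral_indicator (MeasurableSet.univ_pi hs)]
  simp only [withDensity_apply _ (hs _), ← lintegral_indicator (hs _)]
  rw [← lintegral_fin_prod_eq_prod μ fun i => hf.indicator (hs i)]
  refine lintegral_congr fun z => ?_
  classical
  by_cases h : z ∈ Set.univ.pi s
  · rw [Set.indicator_of_mem h]
    exact Finset.prod_congr rfl fun i _ => (Set.indicator_of_mem (h i (Set.mem_univ i)) f).symm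
  · rw [Set.indicator_of_notMem h]
    simp only [Set.mem_pi, Set.mem_univ, true_implies, not_forall] at h
    obtain ⟨i, hi⟩ := h
    exact (Finset.prod_eq_zero (Finset.mem_univ i) (Set.indicator_of_notMem hi f)).symm

/-! ### The squared norm of a Gaussian vector. -/

section Gaussian

variable (E : Type*) [NormedAddCommGroup E] [NormedSpace ℝ E] [FiniteDimensional ℝ E]
  [Nontrivial E] [MeasurableSpace E] [BorelSpace E]

theorem integrable_exp_neg_norm_sq (μ : Measure E) [μ.IsAddHaarMeasure] :
    Integrable (fun z : E => Real.exp (-‖z‖ ^ 2)) μ := by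
  rw [integrable_fun_norm_addHaar μ (f := fun y => Real.exp (-y ^ 2))]
  have h := integrableOn_rpow_mul_exp_neg_rpow (p := 2)
    (s := ((Module.finrank ℝ E - 1 : ℕ) : ℝ)) (by
      have : (0 : ℝ) ≤ ((Module.finrank ℝ E - 1 : ℕ) : ℝ) := Nat.cast_nonneg _
      linarith) two_pos
  simpa [Real.rpow_natCast] using h

/-- The squared norm of a vector with density proportional to `exp (-‖z‖ ^ 2)` is a Gamma
variable. -/
theorem exists_map_norm_sq_withDensity_eq_smul_gammaMeasure (μ : Measure E)
    [μ.IsAddHaarMeasure] :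
    ∃ c : ℝ≥0∞, c ≠ 0 ∧ c ≠ ∞ ∧
      (μ.withDensity fun z => ENNReal.ofReal (Real.exp (-‖z‖ ^ 2))).map (fun z => ‖z‖ ^ 2) =
        c • gammaMeasure ((Module.finrank ℝ E : ℝ) / 2) 1 := by
  set b := Module.finrank ℝ E with hb
  have hb1 : 1 ≤ b := Module.finrank_pos
  have hb0 : (0 : ℝ) < b / 2 := by
    have : (0 : ℝ) < b := by exact_mod_cast hb1
    positivity
  have hball : 0 < μ.real (Metric.ball (0 : E) 1) :=
    ENNReal.toReal_pos (Metric.measure_ball_pos μ 0 one_pos).ne' measure_ball_lt_top.ne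
  -- `K` is the total mass of `exp (-‖z‖ ^ 2)`: in polar coordinates, `b` times the volume of the
  -- unit ball times `∫ y ^ (b - 1) * exp (-y ^ 2) = Γ(b / 2) / 2`.
  set K : ℝ := b * μ.real (Metric.ball (0 : E) 1) * (Real.Gamma (b / 2) / 2) with hK
  have hK0 : 0 < K := by
    have : (0 : ℝ) < b := by exact_mod_cast hb1
    have := Real.Gamma_pos_of_pos hb0
    positivity
  have hprob := isProbabilityMeasure_gammaMeasure hb0 one_pos
  refine ⟨ENNReal.ofReal K, by simpa using hK0, ENNReal.ofReal_ne_top, ?_⟩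
  ext s hs
  have hmeas : Measurable fun z : E => ‖z‖ ^ 2 := measurable_norm.pow_const 2
  rw [Measure.map_apply hmeas hs, withDensity_apply _ (hmeas hs), Measure.smul_apply, smul_eq_mul,
    gammaMeasure, withDensity_apply _ hs]
  have hint := integrable_exp_neg_norm_sq E μ
  have hgint : Integrable (gammaPDFReal (b / 2) 1) := by
    refine ⟨(measurable_gammaPDFReal _ _).aestronglyMeasurable, ?_⟩
    rw [hasFiniteIntegral_iff_ofReal (ae_of_all _ (gammaPDFReal_nonneg hb0 one_pos))]
    have := lintegral_gammaPDF_eq_one hb0 one_pos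
    simp only [gammaPDF] at this
    simp [this]
  simp only [gammaPDF]
  rw [← ofReal_integral_eq_lintegral_ofReal hint.integrableOn
      (ae_of_all _ fun z => (Real.exp_pos _).le),
    ← ofReal_integral_eq_lintegral_ofReal hgint.integrableOn
      (ae_of_all _ (gammaPDFReal_nonneg hb0 one_pos)), ← ENNReal.ofReal_mul hK0.le]
  congr 1
  have h1 : ∫ z in (fun z : E => ‖z‖ ^ 2) ⁻¹' s, Real.exp (-‖z‖ ^ 2) ∂μ =
      b • μ.real (Metric.ball 0 1) •
        ∫ y in Set.Ioi (0 : ℝ), y ^ (b - 1) • s.indicator (fun t => Real.exp (-t)) (y ^ 2) := by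
    rw [← integral_indicator (hmeas hs)]
    exact integral_fun_norm_addHaar μ fun y : ℝ => s.indicator (fun t => Real.exp (-t)) (y ^ 2)
  have h2 : ∫ t in s, gammaPDFReal (b / 2) 1 t =
      ∫ t in Set.Ioi 0, s.indicator (gammaPDFReal (b / 2) 1) t := by
    rw [← integral_indicator hs, ← integral_Ici_eq_integral_Ioi, ← integral_indicator
      measurableSet_Ici]
    refine integral_congr_ae (ae_of_all _ fun t => ?_)
    by_cases ht : 0 ≤ t
    · simp [Set.indicator, ht]
    · simp [Set.indicator, ht, gammaPDFReal]
  -- Substitution `t = y ^ 2` in the Gamma integral, to match the radial integral.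
  rw [h1, h2, ← integral_comp_rpow_Ioi_of_pos
    (g := s.indicator (gammaPDFReal (b / 2) 1)) (p := 2) two_pos,
    nsmul_eq_mul, smul_eq_mul, ← mul_assoc (b : ℝ), hK, mul_assoc (_ * _), ← integral_const_mul (_ / 2)]
  congr 1
  refine setIntegral_congr_fun measurableSet_Ioi fun y hy => ?_
  have hy : 0 < y := hy
  have hG := (Real.Gamma_pos_of_pos hb0).ne'
  simp only [Real.rpow_two, smul_eq_mul]
  by_cases hys : y ^ 2 ∈ s
  · rw [Set.indicator_of_mem hys, Set.indicator_of_mem hys, gammaPDFReal, if_pos (by positivity)]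
    have e : (y ^ 2 : ℝ) ^ ((b : ℝ) / 2 - 1) * y = y ^ (b - 1) := by
      rw [← Real.rpow_natCast y 2, ← Real.rpow_mul hy.le, ← Real.rpow_add_one hy.ne',
        ← Real.rpow_natCast, Nat.cast_sub hb1]
      congr 1
      push_cast; ring
    rw [← e]
    norm_num
    field_simp
  · simp [Set.indicator_of_notMem hys]

end Gaussian

/-! ### Haar measure, unitary invariance of Gaussians, and the Dirichlet law of a column. -/

section Haar

variable {𝕜 : Type*} [RCLike 𝕜]

instance Matrix.unitaryGroup.secondCountableTopology {n : ℕ} :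
    SecondCountableTopology (Matrix.unitaryGroup (Fin n) 𝕜) :=
  have : SecondCountableTopology (Matrix (Fin n) (Fin n) 𝕜) :=
    inferInstanceAs (SecondCountableTopology (Fin n → Fin n → 𝕜))
  TopologicalSpace.Subtype.secondCountableTopology _

instance Matrix.unitaryGroup.compactSpace {n : ℕ} :
    CompactSpace (Matrix.unitaryGroup (Fin n) 𝕜) := by
  refine isCompact_iff_compactSpace.1 ?_
  have hK : IsCompact (Set.univ.pi fun _ : Fin n => Set.univ.pi fun _ : Fin n =>
      Metric.closedBall (0 : 𝕜) 1) :=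
    isCompact_univ_pi fun _ => isCompact_univ_pi fun _ => isCompact_closedBall _ _
  refine IsCompact.of_isClosed_subset (X := Matrix (Fin n) (Fin n) 𝕜) hK
    isClosed_unitary fun U hU => ?_
  intro i _ j _
  simpa using entry_norm_bound_of_unitary hU i j

/-- The Haar probability measure on `U(n)` or `O(n)`. -/
noncomputable def haarUnitary (𝕜 : Type*) [RCLike 𝕜] (n : ℕ) :
    Measure (Matrix.unitaryGroup (Fin n) 𝕜) :=
  Measure.haarMeasure ⊤

instance haarUnitary.isHaarMeasure {n : ℕ} : (haarUnitary 𝕜 n).IsHaarMeasure :=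
  Measure.isHaarMeasure_haarMeasure _

instance haarUnitary.isProbabilityMeasure {n : ℕ} : IsProbabilityMeasure (haarUnitary 𝕜 n) :=
  ⟨Measure.haarMeasure_self (K₀ := (⊤ : TopologicalSpace.PositiveCompacts
    (Matrix.unitaryGroup (Fin n) 𝕜)))⟩

theorem eq_haarUnitary {n : ℕ} (ν : Measure (Matrix.unitaryGroup (Fin n) 𝕜))
    [ν.IsHaarMeasure] [IsProbabilityMeasure ν] : ν = haarUnitary 𝕜 n :=
  Measure.isHaarMeasure_eq_of_isProbabilityMeasure _ _

theorem lintegral_haarUnitary_mul_left {n : ℕ} {f : Matrix.unitaryGroup (Fin n) 𝕜 → ℝ≥0∞}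
    (W : Matrix.unitaryGroup (Fin n) 𝕜) :
    ∫⁻ U, f (W * U) ∂haarUnitary 𝕜 n = ∫⁻ U, f U ∂haarUnitary 𝕜 n :=
  lintegral_mul_left_eq_self f W

/-- Right translation carries Haar measure to another Haar probability measure, which is the same by
uniqueness. -/
theorem lintegral_haarUnitary_mul_right {n : ℕ} {f : Matrix.unitaryGroup (Fin n) 𝕜 → ℝ≥0∞}
    (hf : Measurable f) (W : Matrix.unitaryGroup (Fin n) 𝕜) :
    ∫⁻ U, f (U * W) ∂haarUnitary 𝕜 n = ∫⁻ U, f U ∂haarUnitary 𝕜 n := by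
  have hW : Measurable fun U : Matrix.unitaryGroup (Fin n) 𝕜 => U * W := measurable_mul_const W
  have : IsProbabilityMeasure ((haarUnitary 𝕜 n).map (· * W)) :=
    Measure.isProbabilityMeasure_map hW.aemeasurable
  conv_rhs => rw [← eq_haarUnitary ((haarUnitary 𝕜 n).map (· * W))]
  exact (lintegral_map hf hW).symm

theorem sum_norm_sq_mulVec {d : ℕ} (U : Matrix.unitaryGroup (Fin d) 𝕜) (z : Fin d → 𝕜) :
    ∑ i, ‖((U : Matrix (Fin d) (Fin d) 𝕜).mulVec z) i‖ ^ 2 = ∑ i, ‖z i‖ ^ 2 := by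
  have key : ∀ v : Fin d → 𝕜, ((∑ i, ‖v i‖ ^ 2 : ℝ) : 𝕜) = star v ⬝ᵥ v := fun v => by
    simp [dotProduct, RCLike.conj_mul]
  have h : ((∑ i, ‖((U : Matrix (Fin d) (Fin d) 𝕜).mulVec z) i‖ ^ 2 : ℝ) : 𝕜) =
      ((∑ i, ‖z i‖ ^ 2 : ℝ) : 𝕜) := by
    rw [key, key, Matrix.star_mulVec, Matrix.dotProduct_mulVec, Matrix.vecMul_vecMul,
      ← Matrix.star_eq_conjTranspose, Matrix.UnitaryGroup.star_mul_self, Matrix.vecMul_one]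
  exact_mod_cast h

variable [MeasurableSpace 𝕜] [BorelSpace 𝕜]

/-- The normalising constant need not be computed: the total mass is read off the Gamma image
measure. -/
theorem exists_gaussian_density (𝕜 : Type*) [RCLike 𝕜] [MeasurableSpace 𝕜] [BorelSpace 𝕜] :
    ∃ c : ℝ≥0∞,
      IsProbabilityMeasure ((Measure.addHaar : Measure 𝕜).withDensity
        fun z => c * ENNReal.ofReal (Real.exp (-‖z‖ ^ 2))) ∧
      ((Measure.addHaar : Measure 𝕜).withDensity
        fun z => c * ENNReal.ofReal (Real.exp (-‖z‖ ^ 2))).map (fun z => ‖z‖ ^ 2) =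
        gammaMeasure ((Module.finrank ℝ 𝕜 : ℝ) / 2) 1 := by
  obtain ⟨c, hc0, hc, h⟩ := exists_map_norm_sq_withDensity_eq_smul_gammaMeasure 𝕜
    (Measure.addHaar : Measure 𝕜)
  have hb0 : (0 : ℝ) < (Module.finrank ℝ 𝕜 : ℝ) / 2 := by
    have : (0 : ℝ) < Module.finrank ℝ 𝕜 := by exact_mod_cast Module.finrank_pos (R := ℝ) (M := 𝕜)
    positivity
  have hprob := isProbabilityMeasure_gammaMeasure hb0 one_pos
  have hm : Measurable fun z : 𝕜 => ENNReal.ofReal (Real.exp (-‖z‖ ^ 2)) := by fun_prop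
  have hn : Measurable fun z : 𝕜 => ‖z‖ ^ 2 := measurable_norm.pow_const 2
  have h2 : ((Measure.addHaar : Measure 𝕜).withDensity
      fun z => c⁻¹ * ENNReal.ofReal (Real.exp (-‖z‖ ^ 2))).map (fun z => ‖z‖ ^ 2) =
        gammaMeasure ((Module.finrank ℝ 𝕜 : ℝ) / 2) 1 := by
    have e := withDensity_smul (μ := (Measure.addHaar : Measure 𝕜)) c⁻¹ hm
    have e' : (c⁻¹ • fun z : 𝕜 => ENNReal.ofReal (Real.exp (-‖z‖ ^ 2))) =
      fun z => c⁻¹ * ENNReal.ofReal (Real.exp (-‖z‖ ^ 2)) := rfl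
    rw [← e', e, Measure.map_smul, h, smul_smul, ENNReal.inv_mul_cancel hc0 hc, one_smul]
  refine ⟨c⁻¹, ?_, h2⟩
  rw [← h2] at hprob
  exact ⟨by simpa [Measure.map_apply hn .univ] using hprob.measure_univ⟩

theorem exists_map_mulVec_addHaar {d : ℕ} (U : Matrix.unitaryGroup (Fin d) 𝕜) :
    ∃ k : ℝ≥0∞, (Measure.pi fun _ : Fin d => (Measure.addHaar : Measure 𝕜)).map
      (U : Matrix (Fin d) (Fin d) 𝕜).mulVec =
        k • Measure.pi fun _ : Fin d => (Measure.addHaar : Measure 𝕜) := by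
  let L : Matrix (Fin d) (Fin d) 𝕜 → (Fin d → 𝕜) →ₗ[ℝ] (Fin d → 𝕜) :=
    fun M => M.mulVecLin.restrictScalars ℝ
  have hL : (L (star (U : Matrix (Fin d) (Fin d) 𝕜))).comp (L U) = LinearMap.id := by
    refine LinearMap.ext fun z => ?_
    simp only [L, LinearMap.comp_apply, LinearMap.restrictScalars_apply, Matrix.mulVecLin_apply,
      Matrix.mulVec_mulVec, Matrix.UnitaryGroup.star_mul_self, Matrix.one_mulVec, LinearMap.id_apply]
  have hdet : LinearMap.det (L U) ≠ 0 := by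
    intro h
    have := congrArg LinearMap.det hL
    rw [LinearMap.det_comp, h, mul_zero, LinearMap.det_id] at this
    exact zero_ne_one this
  exact ⟨_, Measure.map_linearMap_addHaar_eq_smul_addHaar
    (Measure.pi fun _ : Fin d => (Measure.addHaar : Measure 𝕜)) hdet⟩

theorem measurable_mulVec {d : ℕ} (M : Matrix (Fin d) (Fin d) 𝕜) : Measurable M.mulVec :=
  (Continuous.matrix_mulVec continuous_const continuous_id).measurable

/-- The density depends only on `∑ i, ‖z i‖ ^ 2`, which `U` preserves, and Lebesgue measure is
scaled by some constant `k`. Testing on the constant function `1` gives `k = 1`, with no determinant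
computed. -/
theorem lintegral_pi_gaussian_mulVec {d : ℕ} (c : ℝ≥0∞)
    [IsProbabilityMeasure ((Measure.addHaar : Measure 𝕜).withDensity
        fun z => c * ENNReal.ofReal (Real.exp (-‖z‖ ^ 2)))]
    (U : Matrix.unitaryGroup (Fin d) 𝕜) {F : (Fin d → 𝕜) → ℝ≥0∞} (hF : Measurable F) :
    ∫⁻ z, F ((U : Matrix (Fin d) (Fin d) 𝕜).mulVec z) ∂(Measure.pi fun _ : Fin d =>
      (Measure.addHaar : Measure 𝕜).withDensity
        fun z => c * ENNReal.ofReal (Real.exp (-‖z‖ ^ 2))) =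
    ∫⁻ z, F z ∂(Measure.pi fun _ : Fin d => (Measure.addHaar : Measure 𝕜).withDensity
        fun z => c * ENNReal.ofReal (Real.exp (-‖z‖ ^ 2))) := by
  have hm : Measurable fun z : 𝕜 => c * ENNReal.ofReal (Real.exp (-‖z‖ ^ 2)) := by fun_prop
  have hpi := pi_withDensity_eq (d := d) (Measure.addHaar : Measure 𝕜) hm
  have hprob : IsProbabilityMeasure (Measure.pi fun _ : Fin d =>
    (Measure.addHaar : Measure 𝕜).withDensity
        fun z => c * ENNReal.ofReal (Real.exp (-‖z‖ ^ 2))) := inferInstance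
  rw [hpi] at hprob ⊢
  set D : (Fin d → 𝕜) → ℝ≥0∞ := fun z => ∏ i, c * ENNReal.ofReal (Real.exp (-‖z i‖ ^ 2)) with hD
  set H := Measure.pi fun _ : Fin d => (Measure.addHaar : Measure 𝕜)
  have hDm : Measurable D := by fun_prop
  have hDU : ∀ z, D ((U : Matrix (Fin d) (Fin d) 𝕜).mulVec z) = D z := fun z => by
    simp only [hD, Finset.prod_mul_distrib]
    rw [← ENNReal.ofReal_prod_of_nonneg fun _ _ => (Real.exp_pos _).le,
      ← ENNReal.ofReal_prod_of_nonneg fun _ _ => (Real.exp_pos _).le, ← Real.exp_sum,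
      ← Real.exp_sum, Finset.sum_neg_distrib, Finset.sum_neg_distrib, sum_norm_sq_mulVec]
  obtain ⟨k, hk⟩ := exists_map_mulVec_addHaar U
  have key : ∀ F : (Fin d → 𝕜) → ℝ≥0∞, Measurable F →
      ∫⁻ z, F ((U : Matrix (Fin d) (Fin d) 𝕜).mulVec z) ∂H.withDensity D =
        k * ∫⁻ z, F z ∂H.withDensity D := fun F hF => by
    have hFU : Measurable fun z => F ((U : Matrix (Fin d) (Fin d) 𝕜).mulVec z) :=
      hF.comp (measurable_mulVec _)
    rw [lintegral_withDensity_eq_lintegral_mul _ hDm hFU,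
      lintegral_withDensity_eq_lintegral_mul _ hDm hF, ← smul_eq_mul k, ← lintegral_smul_measure,
      ← hk, lintegral_map (hDm.mul hF) (measurable_mulVec _)]
    simp only [Pi.mul_apply, hDU]
    rfl
  have h1 := key (fun _ => 1) measurable_const
  simp only [lintegral_const, measure_univ, mul_one] at h1
  rw [key F hF, ← h1, one_mul]

/-- The squared moduli of the entries of the last column of a Haar distributed unitary matrix have
the Dirichlet distribution. -/
theorem lintegral_dirichletMeasure_eq_lintegral_haarUnitary {e : ℕ}
    {f : (Fin (e + 1) → ℝ) → ℝ≥0∞} (hf : Measurable f) :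
    ∫⁻ w, f w ∂dirichletMeasure (fun _ : Fin (e + 1) => (Module.finrank ℝ 𝕜 : ℝ) / 2) =
      ∫⁻ U, f (fun j => ‖(U : Matrix (Fin (e + 1)) (Fin (e + 1)) 𝕜) j (Fin.last e)‖ ^ 2)
        ∂haarUnitary 𝕜 (e + 1) := by
  obtain ⟨c, hprob, hmap⟩ := exists_gaussian_density 𝕜
  set γ := (Measure.addHaar : Measure 𝕜).withDensity
        fun z => c * ENNReal.ofReal (Real.exp (-‖z‖ ^ 2)) with hγ
  have hn : Measurable fun z : 𝕜 => ‖z‖ ^ 2 := measurable_norm.pow_const 2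
  have hnorm : Measurable fun (x : Fin (e + 1) → ℝ) j => x j / ∑ l, x l := by fun_prop
  have hsq : Measurable fun (z : Fin (e + 1) → 𝕜) j => ‖z j‖ ^ 2 := by fun_prop
  set F : (Fin (e + 1) → 𝕜) → ℝ≥0∞ := fun z => f fun j => ‖z j‖ ^ 2 / ∑ l, ‖z l‖ ^ 2 with hF
  have hFm : Measurable F := hf.comp (hnorm.comp hsq)
  have : IsProbabilityMeasure (γ.map fun z => ‖z‖ ^ 2) :=
    Measure.isProbabilityMeasure_map hn.aemeasurable
  have hpi : (Measure.pi fun _ : Fin (e + 1) => gammaMeasure ((Module.finrank ℝ 𝕜 : ℝ) / 2) 1) =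
      (Measure.pi fun _ : Fin (e + 1) => γ).map fun z j => ‖z j‖ ^ 2 := by
    rw [Measure.pi_map_pi fun _ => hn.aemeasurable, hmap]
  have hfn : Measurable fun x : Fin (e + 1) → ℝ => f fun j => x j / ∑ l, x l := hf.comp hnorm
  rw [dirichletMeasure, lintegral_map hf hnorm, hpi, lintegral_map hfn hsq]
  change ∫⁻ z, F z ∂(Measure.pi fun _ : Fin (e + 1) => γ) = _
  -- The Gaussian vector `z` is replaced by `U z` and averaged over Haar `U`; after swapping the
  -- integrals, `z` is fixed and only `U` is random.
  have h1 : ∫⁻ z, F z ∂(Measure.pi fun _ : Fin (e + 1) => γ) =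
      ∫⁻ U : Matrix.unitaryGroup (Fin (e + 1)) 𝕜, ∫⁻ z,
        F ((U : Matrix (Fin (e + 1)) (Fin (e + 1)) 𝕜).mulVec z)
          ∂(Measure.pi fun _ : Fin (e + 1) => γ) ∂haarUnitary 𝕜 (e + 1) := by
    simp only [hγ, lintegral_pi_gaussian_mulVec c _ hFm, lintegral_const, measure_univ, mul_one]
  rw [h1, lintegral_lintegral_swap]
  · have hne : ∀ᵐ z ∂(Measure.pi fun _ : Fin (e + 1) => γ), z ≠ 0 := by
      have hac : (Measure.pi fun _ : Fin (e + 1) => γ) ≪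
          Measure.pi fun _ : Fin (e + 1) => (Measure.addHaar : Measure 𝕜) := by
        rw [hγ, pi_withDensity_eq _ (by fun_prop)]
        exact withDensity_absolutelyContinuous _ _
      refine hac.ae_le ?_
      have : (nhdsWithin (0 : 𝕜) {0}ᶜ).NeBot := Module.punctured_nhds_neBot ℝ 𝕜 0
      have := Measure.IsAddHaarMeasure.nullSingletonClass (Measure.addHaar : Measure 𝕜)
      exact Measure.ae_ne _ 0
    have h2 : ∀ᵐ z ∂(Measure.pi fun _ : Fin (e + 1) => γ),
        ∫⁻ U : Matrix.unitaryGroup (Fin (e + 1)) 𝕜,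
          F ((U : Matrix (Fin (e + 1)) (Fin (e + 1)) 𝕜).mulVec z) ∂haarUnitary 𝕜 (e + 1) =
        ∫⁻ U, f (fun j => ‖(U : Matrix (Fin (e + 1)) (Fin (e + 1)) 𝕜) j (Fin.last e)‖ ^ 2)
          ∂haarUnitary 𝕜 (e + 1) := by
      filter_upwards [hne] with z hz
      have hs : 0 < ∑ l, ‖z l‖ ^ 2 := by
        obtain ⟨i, hi⟩ := Function.ne_iff.1 hz
        exact Finset.sum_pos' (fun _ _ => by positivity)
          ⟨i, Finset.mem_univ i, by have := norm_pos_iff.2 hi; positivity⟩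
      set s := √(∑ l, ‖z l‖ ^ 2) with hs_def
      have hs0 : 0 < s := Real.sqrt_pos.2 hs
      have hs2 : s ^ 2 = ∑ l, ‖z l‖ ^ 2 := Real.sq_sqrt hs.le
      -- With `z / ‖z‖` (Euclidean norm) as last column of `W`, the vector `U z / ‖z‖` is the last
      -- column of `U * W`, and right invariance removes `W`.
      obtain ⟨W, hW⟩ := exists_unitary_last_column (fun j => ((s⁻¹ : ℝ) : 𝕜) * z j) (by
        simp only [norm_mul, mul_pow, ← Finset.mul_sum, ← hs2]
        simp [hs0.ne'])
      have hcol : Measurable fun U : Matrix.unitaryGroup (Fin (e + 1)) 𝕜 =>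
          f (fun j => ‖(U : Matrix (Fin (e + 1)) (Fin (e + 1)) 𝕜) j (Fin.last e)‖ ^ 2) :=
        hf.comp (measurable_pi_lambda _ fun j => hn.comp (measurable_coe_unitaryGroup j _))
      rw [← lintegral_haarUnitary_mul_right hcol W]
      refine lintegral_congr fun U => ?_
      simp only [hF]
      congr 1
      funext j
      rw [sum_norm_sq_mulVec, ← hs2]
      have : ((U * W : Matrix.unitaryGroup (Fin (e + 1)) 𝕜) :
          Matrix (Fin (e + 1)) (Fin (e + 1)) 𝕜) j (Fin.last e) =
            ((s⁻¹ : ℝ) : 𝕜) * (U : Matrix (Fin (e + 1)) (Fin (e + 1)) 𝕜).mulVec z j := by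
        rw [Matrix.UnitaryGroup.mul_val, Matrix.mul_apply, Matrix.mulVec, dotProduct,
          Finset.mul_sum]
        refine Finset.sum_congr rfl fun i _ => ?_
        rw [hW]; ring
      rw [this, norm_mul, mul_pow, RCLike.norm_ofReal, sq_abs, inv_pow, div_eq_inv_mul]
    rw [lintegral_congr_ae h2, lintegral_const, measure_univ, mul_one]
  · refine (hFm.comp ?_).aemeasurable
    refine measurable_pi_lambda _ fun i => ?_
    simp only [Matrix.mulVec, dotProduct]
    exact Finset.measurable_fun_sum _ fun k _ =>
      ((measurable_coe_unitaryGroup i k).comp measurable_fst).mul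
        ((measurable_pi_apply k).comp measurable_snd)

end Haar

/-! ### The two Markov chains and their common kernel. -/

section Chain

variable {𝕜 : Type*} [RCLike 𝕜]

theorem continuous_extendUnitary {d n : ℕ} (h : d ≤ n) :
    Continuous (extendUnitary h : Matrix.unitaryGroup (Fin d) 𝕜 → _) := by
  refine Continuous.subtype_mk ?_ _
  unfold extendMatrix
  exact ((continuous_const.matrix_mul continuous_subtype_val).matrix_mul continuous_const).add
    continuous_const

theorem sum_norm_sq_column_eq_one {d : ℕ} (U : Matrix.unitaryGroup (Fin d) 𝕜) (k : Fin d) :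
    ∑ j, ‖(U : Matrix (Fin d) (Fin d) 𝕜) j k‖ ^ 2 = 1 := by
  have h := sum_norm_sq_mulVec U (Pi.single k 1)
  rw [Matrix.mulVec_single_one] at h
  simp only [Matrix.col_apply] at h
  rw [h, Finset.sum_eq_single k] <;> simp +contextual

theorem isProbabilityMeasure_dirichletMeasure {k : ℕ} {a : Fin k → ℝ} (ha : ∀ j, 0 < a j) :
    IsProbabilityMeasure (dirichletMeasure a) := by
  have := fun j => isProbabilityMeasure_gammaMeasure (ha j) one_pos
  exact Measure.isProbabilityMeasure_map (by fun_prop)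

/-- Resampling one coordinate of a product probability measure does not change its law. -/
theorem lintegral_pi_eq_lintegral_update {ι : Type*} [Fintype ι] [DecidableEq ι] {X : ι → Type*}
    [∀ i, MeasurableSpace (X i)] (μ : ∀ i, Measure (X i)) [∀ i, IsProbabilityMeasure (μ i)]
    {f : (∀ i, X i) → ℝ≥0∞} (hf : Measurable f) (i : ι) :
    ∫⁻ x, f x ∂Measure.pi μ = ∫⁻ x, ∫⁻ y, f (Function.update x i y) ∂μ i ∂Measure.pi μ := by
  refine lintegral_eq_of_lmarginal_eq (μ := μ) {i} hf ?_ ?_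
  · have := hf.lmarginal (μ := μ) (s := {i})
    rwa [lmarginal_singleton] at this
  · simp [lmarginal_singleton]

/-- Two sequences of random variables, constructed by the same random steps, have the same law. -/
theorem lintegral_eq_of_lintegral_update {S Ω Ω' : Type*} [MeasurableSpace S] [MeasurableSpace Ω]
    [MeasurableSpace Ω'] {μ : Measure Ω} {μ' : Measure Ω'}
    {A : Ω → ℕ → S} {B : Ω' → ℕ → S} {n : ℕ} {W : ℕ → Type*} [∀ m, MeasurableSpace (W m)]
    (D : ∀ m, Measure (W m)) [∀ m, SFinite (D m)] {T : ∀ m, S → W m → S}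
    (hT : ∀ m, Measurable fun q : S × W m => T m q.1 q.2)
    (hA : ∀ m < n, ∀ F : (ℕ → S) → ℝ≥0∞, Measurable F → DependsOn F (Set.Iic (m + 1)) →
      ∫⁻ ω, F (A ω) ∂μ =
        ∫⁻ ω, ∫⁻ w, F (Function.update (A ω) (m + 1) (T m (A ω m) w)) ∂D m ∂μ)
    (hB : ∀ m < n, ∀ F : (ℕ → S) → ℝ≥0∞, Measurable F → DependsOn F (Set.Iic (m + 1)) →
      ∫⁻ ω, F (B ω) ∂μ' =
        ∫⁻ ω, ∫⁻ w, F (Function.update (B ω) (m + 1) (T m (B ω m) w)) ∂D m ∂μ')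
    (h0 : ∀ F : (ℕ → S) → ℝ≥0∞, Measurable F → DependsOn F (Set.Iic 0) →
      ∫⁻ ω, F (A ω) ∂μ = ∫⁻ ω, F (B ω) ∂μ')
    (m : ℕ) (hm : m ≤ n) (F : (ℕ → S) → ℝ≥0∞) (hF : Measurable F)
    (hFm : DependsOn F (Set.Iic m)) :
    ∫⁻ ω, F (A ω) ∂μ = ∫⁻ ω, F (B ω) ∂μ' := by
  induction m generalizing F with
  | zero => exact h0 F hF hFm
  | succ m ih =>
    rw [hA m hm F hF hFm, hB m hm F hF hFm]
    -- Integrating out the last step leaves a measurable function of the coordinates up to `m`, the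
    -- same for both chains.
    refine ih (by omega)
      (fun a => ∫⁻ w, F (Function.update a (m + 1) (T m (a m) w)) ∂D m) ?_ ?_
    · refine Measurable.lintegral_prod_right'
        (f := fun q : (ℕ → S) × W m => F (Function.update q.1 (m + 1) (T m (q.1 m) q.2))) ?_
      refine hF.comp (measurable_pi_lambda _ fun i => ?_)
      by_cases hi : i = m + 1
      · subst hi
        simp only [Function.update_self]
        have hp : Measurable fun q : (ℕ → S) × W m => (q.1 m, q.2) :=
          ((measurable_pi_apply m).comp measurable_fst).prodMk measurable_snd
        exact (hT m).comp hp
      · simp only [Function.update_of_ne hi]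
        exact (measurable_pi_apply i).comp measurable_fst
    · intro a b hab
      refine lintegral_congr fun w => hFm fun i hi => ?_
      by_cases hi' : i = m + 1
      · subst hi'
        simp only [Function.update_self]
        rw [hab m (Set.mem_Iic.2 le_rfl)]
      · simp only [Function.update_of_ne hi']
        exact hab i (Set.mem_Iic.2 (by have := Set.mem_Iic.1 hi; omega))

variable [MeasurableSpace 𝕜] [BorelSpace 𝕜]

/-- The Dirichlet distribution with all parameters equal to `1 / 2` for `ℝ` and `1` for `ℂ`. -/
noncomputable def dirichletField (𝕜 : Type*) [RCLike 𝕜] (k : ℕ) : Measure (Fin k → ℝ) :=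
  dirichletMeasure fun _ => (Module.finrank ℝ 𝕜 : ℝ) / 2

instance dirichletField.isProbabilityMeasure {k : ℕ} :
    IsProbabilityMeasure (dirichletField 𝕜 k) :=
  isProbabilityMeasure_dirichletMeasure fun _ => by
    have : (0 : ℝ) < Module.finrank ℝ 𝕜 := by exact_mod_cast Module.finrank_pos (R := ℝ) (M := 𝕜)
    positivity

/-- Columns of unitary matrices have squared moduli in the simplex, and the equality of laws
transfers this. For `k = 0` the sum would be `0`. -/
theorem ae_dirichletField_mem_simplex {k : ℕ} (hk : k ≠ 0) :
    ∀ᵐ w ∂dirichletField 𝕜 k, (∀ j, 0 ≤ w j) ∧ ∑ j, w j = 1 := by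
  obtain ⟨e, rfl⟩ := Nat.exists_eq_succ_of_ne_zero hk
  have hS : MeasurableSet {w : Fin (e + 1) → ℝ | (∀ j, 0 ≤ w j) ∧ ∑ j, w j = 1} := by
    measurability
  have h := lintegral_dirichletMeasure_eq_lintegral_haarUnitary (𝕜 := 𝕜) (e := e)
    (measurable_one.indicator hS.compl)
  rw [lintegral_indicator_one hS.compl] at h
  rw [ae_iff]
  refine h.trans ?_
  rw [lintegral_eq_zero_of_ae_eq_zero]
  refine ae_of_all _ fun U => Set.indicator_of_notMem ?_ _
  simp only [Set.mem_compl_iff, not_not]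
  exact ⟨fun j => by positivity, sum_norm_sq_column_eq_one U _⟩

/-- By the spectral theorem `M = W* Diag(x) W`; left invariance of Haar measure absorbs `W`, so only
the spectrum of `M` matters. -/
theorem lintegral_charpoly_minor {d e : ℕ} (hd : d = e + 1) (h : e ≤ d)
    {M : Matrix (Fin d) (Fin d) 𝕜} (hM : M.IsHermitian) {f : 𝕜[X] → ℝ≥0∞} (hf : Measurable f) :
    ∫⁻ V : Matrix.unitaryGroup (Fin d) 𝕜,
      f ((star (V : Matrix (Fin d) (Fin d) 𝕜) * M * (V : Matrix (Fin d) (Fin d) 𝕜)).submatrix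
        (Fin.castLE h) (Fin.castLE h)).charpoly ∂haarUnitary 𝕜 d =
      ∫⁻ w, f (polyStep M.charpoly w) ∂dirichletField 𝕜 d := by
  subst hd
  obtain ⟨x, W, hx, rfl⟩ := hM.exists_eq_conjDiag
  simp only [← conjDiag_mul]
  rw [lintegral_haarUnitary_mul_left (f := fun U => f ((conjDiag x U).submatrix
    (Fin.castLE h) (Fin.castLE h)).charpoly) W, charpoly_conjDiag]
  simp only [polyStep, measurableRoots_map_polyOfRoots hx]
  rw [dirichletField, lintegral_dirichletMeasure_eq_lintegral_haarUnitary (𝕜 := 𝕜)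
    (f := fun w => f ((weightedDerivative x w).map (algebraMap ℝ 𝕜)))]
  · refine lintegral_congr fun U => ?_
    rw [← charpoly_minor_conjDiag]
    rfl
  · exact hf.comp (Measurable.polynomial_map measurable_algebraMap_real
      (Measurable.weightedDerivative measurable_const measurable_id))

theorem lintegral_charpoly_topLeftMinor_eq_update {n m : ℕ} (hm : m < n) (x : Fin n → ℝ)
    {F : (ℕ → 𝕜[X]) → ℝ≥0∞} (hF : Measurable F) (hFm : DependsOn F (Set.Iic (m + 1))) :
    ∫⁻ U, F (fun i => (topLeftMinor (conjDiag x U) i).charpoly) ∂haarUnitary 𝕜 n =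
      ∫⁻ U, ∫⁻ w, F (Function.update (fun i => (topLeftMinor (conjDiag x U) i).charpoly) (m + 1)
        (polyStep (topLeftMinor (conjDiag x U) m).charpoly w)) ∂dirichletField 𝕜 (n - m)
          ∂haarUnitary 𝕜 n := by
  have hd : n - m ≤ n := Nat.sub_le n m
  set A : Matrix.unitaryGroup (Fin n) 𝕜 → ℕ → 𝕜[X] :=
    fun U i => (topLeftMinor (conjDiag x U) i).charpoly with hA
  have hAm : Measurable A := measurable_pi_lambda _ fun i =>
    measurable_charpoly_topLeftMinor measurable_const measurable_id i
  have hFA : Measurable fun U => F (A U) := hF.comp hAm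
  -- An independent Haar `V` of size `n - m` is introduced at no cost, by right invariance for each
  -- fixed `V`.
  have h1 : ∫⁻ U, F (A U) ∂haarUnitary 𝕜 n = ∫⁻ V : Matrix.unitaryGroup (Fin (n - m)) 𝕜,
      ∫⁻ U, F (A (U * extendUnitary hd V)) ∂haarUnitary 𝕜 n ∂haarUnitary 𝕜 (n - m) := by
    simp only [lintegral_haarUnitary_mul_right hFA, lintegral_const, measure_univ, mul_one]
  have hmul : Measurable fun q : Matrix.unitaryGroup (Fin (n - m)) 𝕜 ×
      Matrix.unitaryGroup (Fin n) 𝕜 => q.2 * extendUnitary hd q.1 :=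
    measurable_snd.mul ((continuous_extendUnitary hd).measurable.comp measurable_fst)
  rw [h1, lintegral_lintegral_swap (f := fun V U => F (A (U * extendUnitary hd V)))
    (hFA.comp hmul).aemeasurable]
  refine lintegral_congr fun U => ?_
  have hH : (topLeftMinor (conjDiag x U) m).IsHermitian := (isHermitian_conjDiag x U).submatrix _
  have hle : n - (m + 1) ≤ n - m := by omega
  rw [← lintegral_charpoly_minor (f := fun p => F (Function.update (A U) (m + 1) p))
    (e := n - (m + 1)) (by omega) hle hH (hF.comp (measurable_update _))]
  -- Blocks with index `i ≤ m` have size at least `n - m` and do not see `V`; smaller blocks beyond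
  -- index `m + 1` are invisible to `F`.
  refine lintegral_congr fun V => hFm fun i hi => ?_
  by_cases hi' : i = m + 1
  · subst hi'
    rw [Function.update_self]
    exact congrArg Matrix.charpoly (submatrix_conjDiag_mul_extendUnitary_of_le hle hd x U V)
  · rw [Function.update_of_ne hi']
    have : n - m ≤ n - i := by have := Set.mem_Iic.1 hi; omega
    exact charpoly_submatrix_conjDiag_mul_extendUnitary this (Nat.sub_le n i) x U V

/-- Extension by zero of a finite family of weight vectors. -/
noncomputable def extendWeights {n : ℕ} (rho : (m : Fin n) → Fin (n - m) → ℝ) (m : ℕ) :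
    Fin (n - m) → ℝ :=
  if h : m < n then rho ⟨m, h⟩ else 0

theorem extendWeights_of_lt {n : ℕ} (rho : (m : Fin n) → Fin (n - m) → ℝ) {m : ℕ} (h : m < n) :
    extendWeights rho m = rho ⟨m, h⟩ := dif_pos h

theorem measurable_extendWeights {n : ℕ} :
    Measurable (extendWeights : ((m : Fin n) → Fin (n - m) → ℝ) → _) := by
  refine measurable_pi_lambda _ fun m => ?_
  by_cases h : m < n
  · simpa only [extendWeights_of_lt _ h] using measurable_pi_apply (⟨m, h⟩ : Fin n)
  · simp only [extendWeights, h, dite_false, measurable_const]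

/-- The chain up to index `m` uses only weights of index below `m`, so resampling the weight of
index `m` affects only index `m + 1` among those that `F` sees. -/
theorem lintegral_polyChain_eq_update {n m : ℕ} (hm : m < n) (x : Fin n → ℝ)
    {F : (ℕ → 𝕜[X]) → ℝ≥0∞} (hF : Measurable F) (hFm : DependsOn F (Set.Iic (m + 1))) :
    ∫⁻ rho, F (polyChain 𝕜 x (extendWeights rho))
        ∂(Measure.pi fun m : Fin n => dirichletField 𝕜 (n - m)) =
      ∫⁻ rho, ∫⁻ w, F (Function.update (polyChain 𝕜 x (extendWeights rho)) (m + 1)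
        (polyStep (polyChain 𝕜 x (extendWeights rho) m) w)) ∂dirichletField 𝕜 (n - m)
          ∂(Measure.pi fun m : Fin n => dirichletField 𝕜 (n - m)) := by
  have hmeas : Measurable fun rho : (m : Fin n) → Fin (n - m) → ℝ =>
      F (polyChain 𝕜 x (extendWeights rho)) :=
    hF.comp (measurable_pi_lambda _ fun i => (measurable_polyChain i).comp
      (measurable_const.prodMk measurable_extendWeights))
  rw [lintegral_pi_eq_lintegral_update _ hmeas ⟨m, hm⟩]
  refine lintegral_congr fun rho => lintegral_congr fun w => hFm fun i hi => ?_
  have hlt : ∀ j < m, extendWeights (Function.update rho ⟨m, hm⟩ w) j = extendWeights rho j :=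
    fun j hj => by
      have hne : (⟨j, hj.trans hm⟩ : Fin n) ≠ ⟨m, hm⟩ := by simp [hj.ne]
      rw [extendWeights_of_lt _ (hj.trans hm), extendWeights_of_lt _ (hj.trans hm),
        Function.update_of_ne hne]
  by_cases hi' : i = m + 1
  · subst hi'
    rw [Function.update_self, polyChain, polyChain_congr x hlt, extendWeights_of_lt _ hm,
      Function.update_self]
  · rw [Function.update_of_ne hi']
    exact polyChain_congr x fun j hj => hlt j (by have := Set.mem_Iic.1 hi; omega)

theorem lintegral_polyChain_eq_lintegral_charpoly {n : ℕ} (x : Fin n → ℝ)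
    {g : (Fin n → 𝕜[X]) → ℝ≥0∞} (hg : Measurable g) :
    ∫⁻ rho, g (fun m => polyChain 𝕜 x (extendWeights rho) m)
        ∂(Measure.pi fun m : Fin n => dirichletField 𝕜 (n - m)) =
      ∫⁻ U, g (fun m => (topLeftMinor (conjDiag x U) m).charpoly) ∂haarUnitary 𝕜 n := by
  refine lintegral_eq_of_lintegral_update (n := n) (W := fun m => Fin (n - m) → ℝ)
    (A := fun rho => polyChain 𝕜 x (extendWeights rho))
    (B := fun U i => (topLeftMinor (conjDiag x U) i).charpoly)
    (fun m => dirichletField 𝕜 (n - m)) (T := fun m p w => polyStep p w)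
    (fun m => Measurable.polyStep measurable_fst measurable_snd)
    (fun m hm F hF hFm => lintegral_polyChain_eq_update hm x hF hFm)
    (fun m hm F hF hFm => lintegral_charpoly_topLeftMinor_eq_update hm x hF hFm)
    (fun F hF hF0 => ?_) n le_rfl (fun a => g fun m : Fin n => a m)
    (hg.comp (measurable_pi_lambda _ fun m => measurable_pi_apply _)) ?_
  -- Given `x`, the initial polynomial is deterministic and is the same for both chains.
  · set c : ℕ → 𝕜[X] := fun _ => (polyOfRoots x).map (algebraMap ℝ 𝕜)
    have hl : ∀ rho : (m : Fin n) → Fin (n - m) → ℝ,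
        F (polyChain 𝕜 x (extendWeights rho)) = F c := fun rho => hF0 fun i hi => by
      obtain rfl : i = 0 := by simpa using hi
      rfl
    have hr : ∀ U : Matrix.unitaryGroup (Fin n) 𝕜,
        F (fun i => (topLeftMinor (conjDiag x U) i).charpoly) = F c := fun U => hF0 fun i hi => by
      obtain rfl : i = 0 := by simpa using hi
      exact charpoly_conjDiag x U
    simp only [hl, hr, lintegral_const, measure_univ]
  · intro a b hab
    exact congrArg g (funext fun m => hab m (Set.mem_Iic.2 m.2.le))

end Chain

/-! ### Integration over the initial sequence, and the final statement. -/

theorem identDistrib_polySeq_charpoly {𝕜 : Type*} [RCLike 𝕜] [MeasurableSpace 𝕜] [BorelSpace 𝕜]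
    {n : ℕ} {Ω : Type*} [MeasurableSpace Ω] {μ : Measure Ω} [IsProbabilityMeasure μ]
    {β : ℝ≥0∞} {lam : Ω → Fin n → ℝ} {rho : (m : ℕ) → Ω → Fin (n - m) → ℝ}
    (hinput : IsBetaInput μ β n lam rho) (hβ : β = (Module.finrank ℝ 𝕜 : ℝ≥0∞))
    {Ω' : Type*} [MeasurableSpace Ω'] {μ' : Measure Ω'} [IsProbabilityMeasure μ']
    {lam' : Ω' → Fin n → ℝ} {U : Ω' → Matrix.unitaryGroup (Fin n) 𝕜}
    (hlam : IdentDistrib lam' lam μ' μ) (hU : IsIndepHaar μ' lam' U) :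
    IdentDistrib
      (fun ω (m : Fin n) => (polySeq (lam ω) (fun k => rho k ω) m).map (algebraMap ℝ 𝕜))
      (fun ω' (m : Fin n) => (topLeftMinor (conjDiag (lam' ω') (U ω')) m).charpoly) μ μ' := by
  have hlaw : ∀ m < n, HasLaw (rho m) (dirichletField 𝕜 (n - m)) μ := fun m hm => by
    have h := hinput.law_rho (by simp [hβ]) m hm
    rwa [hβ, ENNReal.toReal_natCast] at h
  have hrho : AEMeasurable (fun ω (m : Fin n) => rho m ω) μ :=
    aemeasurable_pi_lambda _ fun m => (hlaw m m.2).aemeasurable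
  have hrho_law : μ.map (fun ω (m : Fin n) => rho m ω) =
      Measure.pi fun m : Fin n => dirichletField 𝕜 (n - m) := by
    rw [(iIndepFun_iff_map_fun_eq_pi_map fun m : Fin n => (hlaw m m.2).aemeasurable).1
      hinput.iIndepFun_rho]
    congr 1
    funext m
    exact (hlaw m m.2).map_eq
  have hjoint : μ.map (fun ω => (lam ω, fun m : Fin n => rho m ω)) =
      (μ.map lam).prod (Measure.pi fun m : Fin n => dirichletField 𝕜 (n - m)) := by
    rw [(indepFun_iff_map_prod_eq_prod_map_map hinput.measurable_lam.aemeasurable hrho).1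
      hinput.indepFun_lam_rho, hrho_law]
  have := hU.isHaar
  have : IsProbabilityMeasure (μ'.map U) := Measure.isProbabilityMeasure_map hU.aemeasurable
  have hjoint' : μ'.map (fun ω => (lam' ω, U ω)) = (μ.map lam).prod (haarUnitary 𝕜 n) := by
    rw [(indepFun_iff_map_prod_eq_prod_map_map hlam.aemeasurable_fst hU.aemeasurable).1
      hU.indep, hlam.map_eq, eq_haarUnitary (μ'.map U)]
  have : IsProbabilityMeasure (μ.map lam) :=
    Measure.isProbabilityMeasure_map hinput.measurable_lam.aemeasurable
  set A : (Fin n → ℝ) × ((m : Fin n) → Fin (n - m) → ℝ) → Fin n → 𝕜[X] :=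
    fun q m => polyChain 𝕜 q.1 (extendWeights q.2) m with hA
  set B : (Fin n → ℝ) × Matrix.unitaryGroup (Fin n) 𝕜 → Fin n → 𝕜[X] :=
    fun q m => (topLeftMinor (conjDiag q.1 q.2) m).charpoly with hB
  have hAm : Measurable A := measurable_pi_lambda _ fun m =>
    (measurable_polyChain m).comp
      (measurable_fst.prodMk (measurable_extendWeights.comp measurable_snd))
  have hBm : Measurable B := measurable_pi_lambda _ fun m =>
    measurable_charpoly_topLeftMinor measurable_fst measurable_snd m
  have hpair : AEMeasurable (fun ω => (lam ω, fun m : Fin n => rho m ω)) μ :=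
    hinput.measurable_lam.aemeasurable.prodMk hrho
  have hpair' : AEMeasurable (fun ω => (lam' ω, U ω)) μ' :=
    hlam.aemeasurable_fst.prodMk hU.aemeasurable
  have hsimplex : ∀ᵐ ω ∂μ, ∀ m : Fin n, (∀ j, 0 ≤ rho m ω j) ∧ ∑ j, rho m ω j = 1 := by
    refine ae_all_iff.2 fun m => ?_
    have h := ae_dirichletField_mem_simplex (𝕜 := 𝕜) (k := n - m) (by omega)
    rw [← (hlaw m m.2).map_eq] at h
    exact ae_of_ae_map (hlaw m m.2).aemeasurable h
  -- Almost surely the weights lie in the simplex, where `measurableRoots` and `sortedRoots` give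
  -- the same chain; this also yields the a.e. measurability of `polySeq`.
  have hAe : (fun ω => A (lam ω, fun m : Fin n => rho m ω)) =ᵐ[μ]
      fun ω (m : Fin n) => (polySeq (lam ω) (fun k => rho k ω) m).map (algebraMap ℝ 𝕜) := by
    filter_upwards [hsimplex] with ω hω
    funext m
    rw [← polyChain_eq_polySeq (lam ω) (fun k => rho k ω) (hinput.monotone_lam ω)
      (fun k hk => (hω ⟨k, hk⟩).1) (fun k hk => (hω ⟨k, hk⟩).2) m m.2.le]
    exact polyChain_congr _ fun i hi => extendWeights_of_lt _ (hi.trans m.2)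
  have hmain : IdentDistrib (fun ω => A (lam ω, fun m : Fin n => rho m ω))
      (fun ω => B (lam' ω, U ω)) μ μ' := by
    refine ⟨hAm.comp_aemeasurable hpair, hBm.comp_aemeasurable hpair', ?_⟩
    have h : (μ.map fun ω => (lam ω, fun m : Fin n => rho m ω)).map A =
        (μ'.map fun ω => (lam' ω, U ω)).map B := by
      rw [hjoint, hjoint']
      -- Both joint laws are products with the same first factor, so it suffices to compare the
      -- integrals at each fixed `x`.
      refine Measure.ext_of_lintegral _ fun g hg => ?_
      have hgA : Measurable fun q => g (A q) := hg.comp hAm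
      have hgB : Measurable fun q => g (B q) := hg.comp hBm
      rw [lintegral_map hg hAm, lintegral_map hg hBm, lintegral_prod _ hgA.aemeasurable,
        lintegral_prod _ hgB.aemeasurable]
      exact lintegral_congr fun x => lintegral_polyChain_eq_lintegral_charpoly x hg
    rw [AEMeasurable.map_map_of_aemeasurable hAm.aemeasurable hpair,
      AEMeasurable.map_map_of_aemeasurable hBm.aemeasurable hpair'] at h
    exact h
  exact (IdentDistrib.of_ae_eq (hAm.comp_aemeasurable hpair) hAe).symm.trans hmain

theorem proposition1 {n : ℕ} (hn : 1 ≤ n)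
    {Ω : Type*} [MeasurableSpace Ω] (μ : Measure Ω) [IsProbabilityMeasure μ]
    (β : ℝ≥0∞) (lam : Ω → Fin n → ℝ) (rho : (m : ℕ) → Ω → Fin (n - m) → ℝ)
    (hinput : IsBetaInput μ β n lam rho) :
    (β = ∞ → ∀ m ≤ n, ∀ ω,
      polySeq (lam ω) (fun k => rho k ω) m =
        C (((n - m).factorial : ℝ) / (n.factorial : ℝ)) *
          derivative^[m] (polySeq (lam ω) (fun k => rho k ω) 0)) ∧
    (β = 2 → ∀ {Ω' : Type*} [MeasurableSpace Ω'] (μ' : Measure Ω') [IsProbabilityMeasure μ']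
      (lam' : Ω' → Fin n → ℝ) (U : Ω' → Matrix.unitaryGroup (Fin n) ℂ),
      IdentDistrib lam' lam μ' μ → IsIndepHaar μ' lam' U →
      IdentDistrib
        (fun ω (m : Fin n) => (polySeq (lam ω) (fun k => rho k ω) m).map (algebraMap ℝ ℂ))
        (fun ω' (m : Fin n) => (topLeftMinor (conjDiag (lam' ω') (U ω')) m).charpoly) μ μ') ∧
    (β = 1 → ∀ {Ω' : Type*} [MeasurableSpace Ω'] (μ' : Measure Ω') [IsProbabilityMeasure μ']
      (lam' : Ω' → Fin n → ℝ) (U : Ω' → Matrix.orthogonalGroup (Fin n) ℝ),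
      IdentDistrib lam' lam μ' μ → IsIndepHaar μ' lam' U →
      IdentDistrib
        (fun ω (m : Fin n) => polySeq (lam ω) (fun k => rho k ω) m)
        (fun ω' (m : Fin n) => (topLeftMinor (conjDiag (lam' ω') (U ω')) m).charpoly) μ μ') := by
  refine ⟨fun hβ m hm ω => ?_, fun hβ Ω' _ μ' _ lam' U hlam hU => ?_,
    fun hβ Ω' _ μ' _ lam' U hlam hU => ?_⟩
  · exact polySeq_eq_iterate_derivative (lam ω) (fun k => rho k ω) (hinput.monotone_lam ω)
      (fun k hk => hinput.rho_eq hβ k hk ω) m hm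
  · exact identDistrib_polySeq_charpoly hinput (by simp [hβ, Complex.finrank_real_complex])
      hlam hU
  · have h := identDistrib_polySeq_charpoly (𝕜 := ℝ) hinput (by simp [hβ]) hlam hU
    simpa only [Algebra.algebraMap_self, Polynomial.map_id] using h
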